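/- Let $\lambda>0$, $p\in(0,1]$, $\mu>0$, $\alpha>2$, $\epsilon\ge 0$ (fractional power control usually takes $0\le\epsilon\le1$), $\sigma^2\ge 0$, $t\ge 0$, and integers $1\le l<k$. The target base station is at the origin $o\in\mathbb{R}^2$, and the users form a homogeneous Poisson point process $\Phi$ on $\mathbb{R}^2$ of intensity $\lambda$. Let $R_j$ be the distance from $o$ to the $j$-th nearest point of $\Phi$. The $k$ nearest points are the scheduled users; every point of $\Phi$ outside the closed ball $B(o,R_k)$ is retained, independently, with probability $p$, and the retained points form the set $\Phi_i$ of interferers. An interferer at $x$ is at distance $D_x=\|x\|$ from $o$, at distance $R_x$ from its own base station, and has fading coefficient $G_x$; the $R_x$ are i.i.d. Rayleigh with density $2\pi p\lambda r e^{-p\lambda\pi r^2}$, $r\ge0$, the $G_x$ are i.i.d. exponential with mean $1/\mu$, and the fading coefficient $G_l$ of the $l$-th user is exponential with mean $1/\mu$. The point process, the thinning, the $R_x$, the $G_x$ and $G_l$ are mutually independent. Set $$I_l=\sum_{x\in\Phi_i}G_xR_x^{\alpha\epsilon}D_x^{-\alpha},\qquad \mathrm{SINR}_l=\frac{G_lR_l^{\alpha(\epsilon-1)}}{I_l+\sigma^2},$$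 and let $\mathcal{L}_{I_l|r_l,r_k}(s)=\mathbb{E}[e^{-sI_l}\mid R_l=r_l,R_k=r_k]$ be the Laplace transform of the interference conditioned on the two distances. Theorem. $I_l<\infty$ almost surely; $(R_l,R_k)$ has the joint density $$f_{R_l,R_k}(r_l,r_k)=\frac{4e^{-\pi r_k^2\lambda}(\lambda\pi)^k r_k r_l^{2l-1}(r_k^2-r_l^2)^{k-l-1}}{(k-l-1)!\,(l-1)!},\qquad 0\le r_l\le r_k$$ (and $0$ elsewhere); and the coverage probability of the $l$-th user is $$\mathbb{P}[\mathrm{SINR}_l>t]=\mathbb{E}\left[\xi(R_l,R_k)\right]=\int_0^\infty\int_{r_l}^\infty\xi(r_l,r_k)f_{R_l,R_k}(r_l,r_k)\,\mathrm{d}r_k\,\mathrm{d}r_l,$$ where $\xi(r_l,r_k)=e^{-\mu t\sigma^2r_l^{\alpha(1-\epsilon)}}\mathcal{L}_{I_l|r_l,r_k}(\mu t r_l^{\alpha(1-\epsilon)})$. Moreover, for almost every $(r_l,r_k)$ with respect to the law of $(R_l,R_k)$, $$\mathcal{L}_{I_l|r_l,r_k}(\mu t r_l^{\alpha(1-\epsilon)})=\exp\left(-2\pi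 p\lambda\int_{r_k}^\infty\left(1-\int_0^\infty\frac{\pi p\lambda e^{-p\lambda\pi q}}{1+t r_l^{\alpha(1-\epsilon)}q^{\alpha\epsilon/2}v^{-\alpha}}\,\mathrm{d}q\right)v\,\mathrm{d}v\right).$$ -/

import Mathlib

open MeasureTheory ProbabilityTheory Set
open scoped ENNReal NNReal

noncomputable section

/-- A random measure `Φ` on `E` is a Poisson point process with intensity measure `Λ`: counts of
sets of finite intensity are Poisson, and counts of pairwise disjoint sets are independent. -/
structure IsPoissonPointProcess {Ω E : Type*} [MeasurableSpace Ω] [MeasurableSpace E]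
    (P : Measure Ω) (Φ : Ω → Measure E) (Λ : Measure E) : Prop where
  measurable_count : ∀ A : Set E, MeasurableSet A → Measurable fun ω => Φ ω A
  poisson_count : ∀ A : Set E, MeasurableSet A → Λ A ≠ ∞ →
    P.map (fun ω => Φ ω A) = (poissonMeasure (Λ A).toNNReal).map (fun n : ℕ => (n : ℝ≥0∞))
  indep_count : ∀ (m : ℕ) (A : Fin m → Set E), (∀ i, MeasurableSet (A i)) →
    Pairwise (fun i j => Disjoint (A i) (A j)) → iIndepFun (fun i ω => Φ ω (A i)) P

/-- The law of the retention mark: kept (`true`) with probability `p`, deleted otherwise. -/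
def thinningMeasure (p : ℝ) : Measure Bool :=
  ENNReal.ofReal p • Measure.dirac true + ENNReal.ofReal (1 - p) • Measure.dirac false

/-- The Rayleigh law with density `2 π c r exp (-c π r²)` on `r ≥ 0`. -/
def rayleighMeasure (c : ℝ) : Measure ℝ :=
  volume.withDensity fun r =>
    ENNReal.ofReal (if 0 ≤ r then 2 * Real.pi * c * r * Real.exp (-(c * Real.pi * r ^ 2)) else 0)

/-- The conditional-thinning uplink model on a probability space `(Ω, P)`. -/
structure UplinkModel {Ω : Type*} [MeasurableSpace Ω] (P : Measure Ω) (lam p mu : ℝ) where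
  /-- The users, in an arbitrary enumeration. -/
  point : ℕ → Ω → EuclideanSpace ℝ (Fin 2)
  /-- Retention mark of each user, used only if the user is not scheduled in the target cell. -/
  kept : ℕ → Ω → Bool
  /-- Distance `R_x` from an interfering user to its own base station. -/
  servDist : ℕ → Ω → ℝ
  /-- Fading coefficient `G_x` from an interfering user to the target base station. -/
  fading : ℕ → Ω → ℝ
  /-- Fading coefficient of the target transmission. -/
  signalFading : Ω → ℝ
  measurable_point : ∀ n, Measurable (point n)
  measurable_kept : ∀ n, Measurable (kept n)
  measurable_servDist : ∀ n, Measurable (servDist n)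
  measurable_fading : ∀ n, Measurable (fading n)
  measurable_signalFading : Measurable signalFading
  /-- The users form a homogeneous Poisson point process of intensity `lam`. -/
  poisson : IsPoissonPointProcess P (fun ω => Measure.sum fun n => Measure.dirac (point n ω))
    (ENNReal.ofReal lam • volume)
  /-- Retention, serving distance and fading of a user are independent, with the stated laws. -/
  mark_law : ∀ n, P.map (fun ω => (kept n ω, servDist n ω, fading n ω)) =
    (thinningMeasure p).prod ((rayleighMeasure (p * lam)).prod (expMeasure mu))
  /-- The marks of distinct users are independent. -/
  mark_indep : iIndepFun (fun n ω => (kept n ω, servDist n ω, fading n ω)) P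
  signalFading_law : P.map signalFading = expMeasure mu
  signalFading_indep :
    IndepFun signalFading (fun ω n => (kept n ω, servDist n ω, fading n ω)) P
  /-- The locations are independent of all fading, thinning and serving distances. -/
  point_indep : IndepFun (fun ω n => point n ω)
    (fun ω => (signalFading ω, fun n => (kept n ω, servDist n ω, fading n ω))) P

namespace UplinkModel

variable {Ω : Type*} [MeasurableSpace Ω] {P : Measure Ω} {lam p mu : ℝ}

/-- The counting measure of the user locations. -/
def users (M : UplinkModel P lam p mu) (ω : Ω) : Measure (EuclideanSpace ℝ (Fin 2)) :=
  Measure.sum fun n => Measure.dirac (M.point n ω)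

/-- `R_j`: the distance from the origin to the `j`-th nearest user. -/
def dist (M : UplinkModel P lam p mu) (j : ℕ) (ω : Ω) : ℝ :=
  sInf {r : ℝ | 0 ≤ r ∧ (j : ℝ≥0∞) ≤ M.users ω (Metric.closedBall 0 r)}

/-- The indices of the interferers: users outside `B(o, R_k)` that survive the thinning. -/
def interferers (M : UplinkModel P lam p mu) (k : ℕ) (ω : Ω) : Set ℕ :=
  {n | M.point n ω ∉ Metric.closedBall 0 (M.dist k ω) ∧ M.kept n ω = true}

open Classical in
/-- The interference `∑ G_x R_x^{αε} D_x^{-α}` over the interferers `x`, with values in `[0, ∞]`. -/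
def interference (M : UplinkModel P lam p mu) (α ε : ℝ) (k : ℕ) (ω : Ω) : ℝ≥0∞ :=
  ∑' n, if n ∈ M.interferers k ω then
    ENNReal.ofReal (M.fading n ω * M.servDist n ω ^ (α * ε) * ‖M.point n ω‖ ^ (-α)) else 0

/-- The SINR of the `l`-th user, with noise power `noise = σ²`. -/
def sinr (M : UplinkModel P lam p mu) (α ε noise : ℝ) (l k : ℕ) (ω : Ω) : ℝ≥0∞ :=
  ENNReal.ofReal (M.signalFading ω * M.dist l ω ^ (α * (ε - 1))) /
    (M.interference α ε k ω + ENNReal.ofReal noise)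

/-- The Laplace transform at `s` of the interference conditioned on `R_l = rl`, `R_k = rk`:
the integral of `exp (-s i)` against the regular conditional law of the interference. -/
def condLaplace [IsFiniteMeasure P] (M : UplinkModel P lam p mu) (α ε : ℝ) (l k : ℕ)
    (rl rk s : ℝ) : ℝ :=
  ∫ i : ℝ≥0∞, Real.exp (-(s * i.toReal))
    ∂(condDistrib (M.interference α ε k) (fun ω => (M.dist l ω, M.dist k ω)) P (rl, rk))

/-- `ξ(rl, rk)`: the coverage probability conditioned on the two distances. -/
def xi [IsFiniteMeasure P] (M : UplinkModel P lam p mu) (α ε noise t : ℝ) (l k : ℕ)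
    (rl rk : ℝ) : ℝ :=
  Real.exp (-(mu * t * noise * rl ^ (α * (1 - ε)))) *
    M.condLaplace α ε l k rl rk (mu * t * rl ^ (α * (1 - ε)))

end UplinkModel

/-- The joint density of `(R_l, R_k)`. -/
def jointDistancePDF (lam : ℝ) (l k : ℕ) (rl rk : ℝ) : ℝ :=
  if 0 ≤ rl ∧ rl ≤ rk then
    4 * Real.exp (-(Real.pi * rk ^ 2 * lam)) * (lam * Real.pi) ^ k * rk * rl ^ (2 * l - 1) *
      (rk ^ 2 - rl ^ 2) ^ (k - l - 1) / ((k - l - 1).factorial * (l - 1).factorial)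
  else 0

end

/-!
# Uplink coverage under conditional thinning

Given the locations of the users, the marks (retention, serving distance, fading) are independent,
so averaging `exp (-s I)` over them gives a product over the users outside the disc `B(o, R_k)`, one
factor `w(x) = E[exp (-s c(x))]` for each, with `c(x)` the contribution of a user at `x`
(`lintegral_expNeg_seqInterference`). This product is `exp (-∫ g dΦ)` over the outside of the disc,
for `g = -log w`. For a Poisson process of intensity measure `Λ`, the Laplace functional is
`E[exp (-∫ g dΦ)] = exp (-∫ (1 - e^{-g}) dΛ)`, and counts in sets where `g` vanishes are independent
of `∫ g dΦ` (`IsPoissonPointProcess.lintegral_mul_expNeg`): both are read off the independence of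
the counts for simple `g` and pass to the limit.

The radius `R_k` is random. Rounded up to a grid it takes countably many values, and the event that
the rounded value is `b` is determined by counts inside `B(o, b)`; so the Laplace functional applies
outside that disc, and letting the mesh tend to zero gives the strong Markov property
`IsPoissonPointProcess.lintegral_mul_expNeg_tailIntegral`: given `(R_l, R_k)`, the points outside
`B(o, R_k)` have the Laplace functional of a Poisson process there. It is checked on the events
`{R_l > x, R_k > y}` with `0 ≤ x ≤ y`, which suffices for two measures carried by
`{0 < r_l ≤ r_k}`. The joint density is found on the same events: there the probability is a double
Poisson sum, whose derivative telescopes to the claimed density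
(`IsPoissonPointProcess.map_nthDist_nthDist`).

It remains to compute `∫ (1 - w) dΛ` over the outside of a disc. Exponential fading gives
`1 / (1 + c q^{αε/2} v^{-α})`, the square `q` of the Rayleigh serving distance is exponential, and
polar coordinates give the stated exponent (`tailIntegral_meanExpContribution`), which is finite
because `α > 2` and continuous in `c`. This identifies the conditional Laplace transform at each
fixed argument almost surely, hence by continuity at all arguments simultaneously, in particular at
the random one in the theorem (`UplinkModel.ae_condLaplace_eq`); the limit `s → 0` shows that the
interference is finite almost surely. For the coverage probability, the fading of the target
transmission is independent of everything else and is integrated out first, which turns the tail of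
an exponential variable into `exp (-s (I + σ²))`.

The computations with possibly infinite sums run in `[0, ∞]`, with `expNeg z = e^{-z}`.
-/

open Filter Topology

/-! ### The function `z ↦ e^{-z}` on `[0, ∞]` -/

/-- `e^{-z}` for `z ∈ [0, ∞]`, with `e^{-∞} = 0`. -/
noncomputable def expNeg (z : ℝ≥0∞) : ℝ≥0∞ := EReal.exp (-(z : EReal))

/-- `-log w` for `w ∈ [0, 1]`, with `-log 0 = ∞` (and the value `0` for `w > 1`). -/
noncomputable def negLog (w : ℝ≥0∞) : ℝ≥0∞ := (-(ENNReal.log w)).toENNReal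

@[simp] lemma expNeg_zero : expNeg 0 = 1 := by simp [expNeg]

@[simp] lemma expNeg_top : expNeg ∞ = 0 := by simp [expNeg]

lemma expNeg_eq_zero {z : ℝ≥0∞} : expNeg z = 0 ↔ z = ∞ := by
  simp [expNeg, EReal.neg_eq_bot_iff]

lemma expNeg_add (a b : ℝ≥0∞) : expNeg (a + b) = expNeg a * expNeg b := by
  rw [expNeg, expNeg, expNeg, ← EReal.exp_add, EReal.coe_ennreal_add, EReal.neg_add, sub_eq_add_neg]
  · exact Or.inl (EReal.coe_ennreal_ne_bot a)
  · exact Or.inr (EReal.coe_ennreal_ne_bot b)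

lemma expNeg_antitone : Antitone expNeg := fun a b h =>
  EReal.exp_monotone (EReal.neg_le_neg_iff.2 (by exact_mod_cast h))

lemma expNeg_le_one (z : ℝ≥0∞) : expNeg z ≤ 1 := by
  simpa using expNeg_antitone (zero_le : 0 ≤ z)

lemma expNeg_ne_top (z : ℝ≥0∞) : expNeg z ≠ ∞ := ((expNeg_le_one z).trans_lt ENNReal.one_lt_top).ne

lemma continuous_expNeg : Continuous expNeg :=
  (EReal.expHomeomorph.continuous).comp (continuous_neg.comp continuous_coe_ennreal_ereal)

@[fun_prop]
lemma measurable_expNeg : Measurable expNeg := continuous_expNeg.measurable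

lemma expNeg_ofReal {x : ℝ} (hx : 0 ≤ x) :
    expNeg (ENNReal.ofReal x) = ENNReal.ofReal (Real.exp (-x)) := by
  rw [expNeg, EReal.coe_ennreal_ofReal, max_eq_left hx, ← EReal.coe_neg, EReal.exp_coe]

lemma expNeg_eq_ofReal {z : ℝ≥0∞} (hz : z ≠ ∞) :
    expNeg z = ENNReal.ofReal (Real.exp (-z.toReal)) := by
  rw [← expNeg_ofReal ENNReal.toReal_nonneg, ENNReal.ofReal_toReal hz]

lemma expNeg_mul_natCast (c : ℝ≥0∞) (n : ℕ) : expNeg (c * n) = expNeg c ^ n := by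
  induction n with
  | zero => simp
  | succ n ih => rw [Nat.cast_succ, mul_add, mul_one, expNeg_add, ih, pow_succ]

lemma expNeg_sum {ι : Type*} (s : Finset ι) (f : ι → ℝ≥0∞) :
    expNeg (∑ i ∈ s, f i) = ∏ i ∈ s, expNeg (f i) := by
  classical
  induction s using Finset.induction_on with
  | empty => simp
  | insert a s ha ih => rw [Finset.sum_insert ha, Finset.prod_insert ha, expNeg_add, ih]

lemma expNeg_negLog {w : ℝ≥0∞} (hw : w ≤ 1) : expNeg (negLog w) = w := by
  have h : 0 ≤ -(ENNReal.log w) := by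
    rw [EReal.le_neg, neg_zero]
    exact ENNReal.log_le_zero_iff.2 hw
  rw [expNeg, negLog, EReal.coe_toENNReal h, neg_neg, ENNReal.exp_log]

@[fun_prop]
lemma measurable_negLog : Measurable negLog := by
  have h : Measurable ENNReal.log := ENNReal.logHomeomorph.continuous.measurable
  exact measurable_ereal_toENNReal.comp (continuous_neg.measurable.comp h)

/-! ### Laplace functional of a Poisson point process -/

lemma lintegral_expNeg_poissonMeasure (r : ℝ≥0) (c : ℝ≥0∞) :
    ∫⁻ n : ℕ, expNeg (c * n) ∂(poissonMeasure r) = expNeg (r * (1 - expNeg c)) := by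
  obtain ⟨y, hy0, hy1, hy⟩ : ∃ y : ℝ, 0 ≤ y ∧ y ≤ 1 ∧ expNeg c = ENNReal.ofReal y :=
    ⟨(expNeg c).toReal, ENNReal.toReal_nonneg, ENNReal.toReal_le_of_le_ofReal zero_le_one
      (by simpa using expNeg_le_one c), (ENNReal.ofReal_toReal (expNeg_ne_top c)).symm⟩
  simp_rw [expNeg_mul_natCast, hy]
  rw [poissonMeasure, lintegral_sum_measure]
  simp only [lintegral_smul_measure, lintegral_dirac, smul_eq_mul]
  have h1 : ∀ n : ℕ, ENNReal.ofReal (Real.exp (-(r : ℝ)) * (r : ℝ) ^ n / (n.factorial : ℝ)) *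
      ENNReal.ofReal y ^ n =
      ENNReal.ofReal (Real.exp (-(r : ℝ)) * ((r * y) ^ n / (n.factorial : ℝ))) := by
    intro n
    rw [← ENNReal.ofReal_pow hy0, ← ENNReal.ofReal_mul (by positivity)]
    congr 1
    rw [mul_pow]; ring
  have h2 : HasSum (fun n : ℕ => Real.exp (-(r : ℝ)) * ((r * y) ^ n / (n.factorial : ℝ)))
      (Real.exp (-(r : ℝ)) * Real.exp (r * y)) := by
    have := (NormedSpace.expSeries_div_hasSum_exp ((r : ℝ) * y)).mul_left (Real.exp (-(r : ℝ)))
    rwa [← Real.exp_eq_exp_ℝ] at this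
  rw [tsum_congr h1, ← ENNReal.ofReal_tsum_of_nonneg (fun n => by positivity) h2.summable,
    h2.tsum_eq, ← Real.exp_add, ← ENNReal.ofReal_one, ← ENNReal.ofReal_sub _ hy0,
    ← ENNReal.ofReal_coe_nnreal, ← ENNReal.ofReal_mul (by positivity), expNeg_ofReal]
  · congr 2; ring
  · exact mul_nonneg r.2 (by linarith)

namespace IsPoissonPointProcess

variable {Ω E : Type*} [MeasurableSpace Ω] [MeasurableSpace E]
  {P : Measure Ω} {Φ : Ω → Measure E} {Λ : Measure E}

lemma measurable (h : IsPoissonPointProcess P Φ Λ) : Measurable Φ :=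
  Measure.measurable_of_measurable_coe _ h.measurable_count

lemma measurable_lintegral (h : IsPoissonPointProcess P Φ Λ) {g : E → ℝ≥0∞} (hg : Measurable g) :
    Measurable fun ω => ∫⁻ z, g z ∂(Φ ω) :=
  (Measure.measurable_lintegral hg).comp h.measurable

lemma iIndepFun_count (h : IsPoissonPointProcess P Φ Λ) {ι : Type*} [Fintype ι] (A : ι → Set E)
    (hA : ∀ i, MeasurableSet (A i)) (hd : Pairwise (Function.onFun Disjoint A)) :
    iIndepFun (fun i ω => Φ ω (A i)) P := by
  have e := Fintype.equivFin ι
  have := h.indep_count (Fintype.card ι) (fun i => A (e.symm i)) (fun i => hA _)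
    (fun i j hij => hd (e.symm.injective.ne hij))
  have h2 := this.precomp e.injective
  simpa using h2

lemma lintegral_expNeg_count_of_ne_top (h : IsPoissonPointProcess P Φ Λ) {C : Set E}
    (hC : MeasurableSet C) (hfin : Λ C ≠ ∞) (c : ℝ≥0∞) :
    ∫⁻ ω, expNeg (c * Φ ω C) ∂P = expNeg ((1 - expNeg c) * Λ C) := by
  have hm : Measurable fun z : ℝ≥0∞ => expNeg (c * z) := by fun_prop
  rw [← lintegral_map hm (h.measurable_count C hC), h.poisson_count C hC hfin,
    lintegral_map hm (by fun_prop), lintegral_expNeg_poissonMeasure, ENNReal.coe_toNNReal hfin,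
    mul_comm]

lemma lintegral_expNeg_count [IsProbabilityMeasure P] [SigmaFinite Λ]
    (h : IsPoissonPointProcess P Φ Λ) {C : Set E} (hC : MeasurableSet C) (c : ℝ≥0∞) :
    ∫⁻ ω, expNeg (c * Φ ω C) ∂P = expNeg ((1 - expNeg c) * Λ C) := by
  have hmeas : ∀ n, MeasurableSet (C ∩ spanningSets Λ n) := fun n =>
    hC.inter (measurableSet_spanningSets Λ n)
  have hmono : Monotone fun n => C ∩ spanningSets Λ n := fun m n hmn =>
    inter_subset_inter_right _ (monotone_spanningSets Λ hmn)
  have hU : ⋃ n, C ∩ spanningSets Λ n = C := by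
    rw [← inter_iUnion, iUnion_spanningSets, inter_univ]
  have hfin : ∀ n, Λ (C ∩ spanningSets Λ n) ≠ ∞ := fun n =>
    ((measure_mono inter_subset_right).trans_lt (measure_spanningSets_lt_top Λ n)).ne
  have hmul : ∀ (ν : Measure E) (a : ℝ≥0∞), Tendsto (fun n => expNeg (a * ν (C ∩ spanningSets Λ n)))
      atTop (𝓝 (expNeg (a * ν C))) := by
    intro ν a
    refine (continuous_expNeg.tendsto _).comp ?_
    have h1 : Tendsto (fun n => (a • ν) (C ∩ spanningSets Λ n)) atTop
        (𝓝 ((a • ν) (⋃ n, C ∩ spanningSets Λ n))) := tendsto_measure_iUnion_atTop hmono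
    simpa [hU] using h1
  have h1 : Tendsto (fun n => ∫⁻ ω, expNeg (c * Φ ω (C ∩ spanningSets Λ n)) ∂P) atTop
      (𝓝 (∫⁻ ω, expNeg (c * Φ ω C) ∂P)) := by
    refine tendsto_lintegral_of_dominated_convergence (fun _ => 1) (fun n => ?_) (fun n => ?_) ?_ ?_
    · have := h.measurable_count _ (hmeas n)
      fun_prop
    · exact ae_of_all _ fun ω => expNeg_le_one _
    · simp
    · exact ae_of_all _ fun ω => hmul (Φ ω) c
  refine tendsto_nhds_unique h1 ?_
  simp_rw [fun n => h.lintegral_expNeg_count_of_ne_top (hmeas n) (hfin n) c]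
  exact hmul Λ _

/-- Counts in finitely many disjoint sets are independent of the Laplace functional of a function
vanishing on these sets: the case of a simple function. -/
lemma lintegral_mul_expNeg_simpleFunc [IsProbabilityMeasure P] [SigmaFinite Λ]
    (h : IsPoissonPointProcess P Φ Λ) {m : ℕ} (A : Fin m → Set E) (hA : ∀ i, MeasurableSet (A i))
    (hd : Pairwise (Function.onFun Disjoint A)) {H : (Fin m → ℝ≥0∞) → ℝ≥0∞} (hH : Measurable H)
    (f : SimpleFunc E ℝ≥0∞) (hf : ∀ i, ∀ z ∈ A i, f z = 0) :
    ∫⁻ ω, H (fun i => Φ ω (A i)) * expNeg (∫⁻ z, f z ∂(Φ ω)) ∂P =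
      (∫⁻ ω, H (fun i => Φ ω (A i)) ∂P) * expNeg (∫⁻ z, (1 - expNeg (f z)) ∂Λ) := by
  classical
  set R := f.range.filter (· ≠ 0) with hR
  let B : Fin m ⊕ R → Set E := Sum.elim A (fun y => f ⁻¹' {(y : ℝ≥0∞)})
  have hB : ∀ i, MeasurableSet (B i) := by
    rintro (i | y)
    · exact hA i
    · exact f.measurableSet_fiber _
  have hBd : Pairwise (Function.onFun Disjoint B) := by
    rintro (i | y) (j | y') hij
    · exact hd (fun h => hij (by rw [h]))
    · refine disjoint_left.2 fun z hz hz' => ?_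
      have h1 : f z = y' := hz'
      exact (Finset.mem_filter.1 y'.2).2 (h1.symm.trans (hf i z hz))
    · refine disjoint_left.2 fun z hz hz' => ?_
      have h1 : f z = y := hz
      exact (Finset.mem_filter.1 y.2).2 (h1.symm.trans (hf j z hz'))
    · refine disjoint_left.2 fun z hz hz' => hij ?_
      have h1 : f z = y := hz
      have h2 : f z = y' := hz'
      rw [Subtype.ext (h1.symm.trans h2)]
  have hind := h.iIndepFun_count B hB hBd
  have hBm : ∀ i, Measurable fun ω => Φ ω (B i) := fun i => h.measurable_count _ (hB i)
  have hblock := hind.indepFun_finset (Finset.univ.map Function.Embedding.inl)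
    (Finset.univ.map Function.Embedding.inr) (by
      rw [Finset.disjoint_left]
      rintro x hx hx'
      simp only [Finset.mem_map, Finset.mem_univ, true_and] at hx hx'
      obtain ⟨a, rfl⟩ := hx
      obtain ⟨b, hb⟩ := hx'
      simp at hb) hBm
  have hI : IndepFun (fun ω => H (fun i => Φ ω (A i)))
      (fun ω => ∏ y : R, expNeg ((y : ℝ≥0∞) * Φ ω (f ⁻¹' {(y : ℝ≥0∞)}))) P := by
    have h1 : Measurable fun a : (↥(Finset.univ.map Function.Embedding.inl : Finset (Fin m ⊕ R)) → ℝ≥0∞) =>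
        H (fun i => a ⟨Sum.inl i, by simp⟩) := by fun_prop
    have h2 : Measurable fun a : (↥(Finset.univ.map Function.Embedding.inr : Finset (Fin m ⊕ R)) → ℝ≥0∞) =>
        ∏ y : R, expNeg ((y : ℝ≥0∞) * a ⟨Sum.inr y, by simp⟩) := by fun_prop
    exact hblock.comp h1 h2
  have hf1 : ∀ ν : Measure E, ∀ u : ℝ≥0∞ → ℝ≥0∞, u 0 = 0 →
      ∫⁻ z, u (f z) ∂ν = ∑ y : R, u y * ν (f ⁻¹' {(y : ℝ≥0∞)}) := by
    intro ν u hu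
    have : ∫⁻ z, u (f z) ∂ν = (f.map u).lintegral ν := by
      rw [← SimpleFunc.lintegral_eq_lintegral]; rfl
    rw [this, SimpleFunc.map_lintegral]
    rw [Finset.sum_coe_sort R (fun y => u y * ν (f ⁻¹' {y})), hR, Finset.sum_filter]
    refine Finset.sum_congr rfl fun y _ => ?_
    by_cases hy : y = 0
    · simp [hy, hu]
    · simp [hy]
  have hf2 : ∀ ω, expNeg (∫⁻ z, f z ∂(Φ ω)) =
      ∏ y : R, expNeg ((y : ℝ≥0∞) * Φ ω (f ⁻¹' {(y : ℝ≥0∞)})) := by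
    intro ω
    have := hf1 (Φ ω) id rfl
    simp only [id] at this
    rw [this, expNeg_sum]
  have hAm : Measurable fun ω => H (fun i => Φ ω (A i)) := by
    have := fun i => h.measurable_count _ (hA i)
    fun_prop
  have hym : ∀ y : R, Measurable fun ω => Φ ω (f ⁻¹' {(y : ℝ≥0∞)}) := fun y => hBm (Sum.inr y)
  simp_rw [hf2]
  rw [lintegral_mul_eq_lintegral_mul_lintegral_of_indepFun'' hAm.aemeasurable
    (by fun_prop) hI]
  congr 1
  have hind2 : iIndepFun (fun (y : R) ω => expNeg ((y : ℝ≥0∞) * Φ ω (f ⁻¹' {(y : ℝ≥0∞)}))) P :=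
    (hind.precomp (g := Sum.inr) Sum.inr_injective).comp
      (fun y z => expNeg ((y : ℝ≥0∞) * z)) (fun y => by fun_prop)
  rw [lintegral_prod_eq_prod_lintegral_of_indepFun _ _ hind2 (fun y => by fun_prop),
    hf1 Λ (fun y => 1 - expNeg y) (by simp), expNeg_sum]
  exact Finset.prod_congr rfl fun y _ => h.lintegral_expNeg_count (hB (Sum.inr y)) _

/-- Counts in finitely many disjoint sets are independent of the points outside these sets, and
the latter have the Laplace functional `g ↦ exp (-∫ (1 - e^{-g}) dΛ)`. -/
lemma lintegral_mul_expNeg [IsProbabilityMeasure P] [SigmaFinite Λ]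
    (h : IsPoissonPointProcess P Φ Λ) {m : ℕ} (A : Fin m → Set E) (hA : ∀ i, MeasurableSet (A i))
    (hd : Pairwise (Function.onFun Disjoint A)) {H : (Fin m → ℝ≥0∞) → ℝ≥0∞} (hH : Measurable H)
    (hH1 : ∀ x, H x ≤ 1) {g : E → ℝ≥0∞} (hg : Measurable g) (hgA : ∀ i, ∀ z ∈ A i, g z = 0) :
    ∫⁻ ω, H (fun i => Φ ω (A i)) * expNeg (∫⁻ z, g z ∂(Φ ω)) ∂P =
      (∫⁻ ω, H (fun i => Φ ω (A i)) ∂P) * expNeg (∫⁻ z, (1 - expNeg (g z)) ∂Λ) := by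
  have hle : ∀ n z, SimpleFunc.eapprox g n z ≤ g z := fun n z => by
    rw [← SimpleFunc.iSup_eapprox_apply hg z]
    exact le_iSup (fun k => SimpleFunc.eapprox g k z) n
  have hlim : ∀ z, Tendsto (fun n => SimpleFunc.eapprox g n z) atTop (𝓝 (g z)) := fun z => by
    rw [← SimpleFunc.iSup_eapprox_apply hg z]
    exact tendsto_atTop_iSup fun a b hab => SimpleFunc.monotone_eapprox g hab z
  have hAm : Measurable fun ω => H (fun i => Φ ω (A i)) := by
    have := fun i => h.measurable_count _ (hA i)
    fun_prop
  have hHint : ∫⁻ ω, H (fun i => Φ ω (A i)) ∂P ≤ 1 :=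
    (lintegral_mono fun ω => hH1 _).trans (by simp)
  have h1 : ∀ ν : Measure E, Tendsto (fun n => ∫⁻ z, SimpleFunc.eapprox g n z ∂ν) atTop
      (𝓝 (∫⁻ z, g z ∂ν)) := fun ν =>
    lintegral_tendsto_of_tendsto_of_monotone
      (fun n => (SimpleFunc.eapprox g n).measurable.aemeasurable)
      (ae_of_all _ fun z a b hab => SimpleFunc.monotone_eapprox g hab z) (ae_of_all _ hlim)
  have h2 : Tendsto (fun n => ∫⁻ z, (1 - expNeg (SimpleFunc.eapprox g n z)) ∂Λ) atTop
      (𝓝 (∫⁻ z, (1 - expNeg (g z)) ∂Λ)) := by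
    refine lintegral_tendsto_of_tendsto_of_monotone (fun n => ?_)
      (ae_of_all _ fun z a b hab => ?_) (ae_of_all _ fun z => ?_)
    · have := (SimpleFunc.eapprox g n).measurable
      fun_prop
    · exact tsub_le_tsub_left (expNeg_antitone (SimpleFunc.monotone_eapprox g hab z)) 1
    · exact ENNReal.Tendsto.sub tendsto_const_nhds ((continuous_expNeg.tendsto _).comp (hlim z))
        (Or.inl ENNReal.one_ne_top)
  have h3 : Tendsto (fun n => ∫⁻ ω, H (fun i => Φ ω (A i)) *
      expNeg (∫⁻ z, SimpleFunc.eapprox g n z ∂(Φ ω)) ∂P) atTop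
      (𝓝 (∫⁻ ω, H (fun i => Φ ω (A i)) * expNeg (∫⁻ z, g z ∂(Φ ω)) ∂P)) := by
    refine tendsto_lintegral_of_dominated_convergence (fun _ => 1) (fun n => ?_) (fun n => ?_) ?_ ?_
    · exact hAm.mul (measurable_expNeg.comp
        (h.measurable_lintegral (SimpleFunc.eapprox g n).measurable))
    · exact ae_of_all _ fun ω => mul_le_one' (hH1 _) (expNeg_le_one _)
    · simp
    · exact ae_of_all _ fun ω => ENNReal.Tendsto.const_mul
        ((continuous_expNeg.tendsto _).comp (h1 _)) (Or.inr ((hH1 _).trans_lt ENNReal.one_lt_top).ne)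
  refine tendsto_nhds_unique h3 ?_
  have h4 : ∀ n, ∫⁻ ω, H (fun i => Φ ω (A i)) *
      expNeg (∫⁻ z, SimpleFunc.eapprox g n z ∂(Φ ω)) ∂P =
      (∫⁻ ω, H (fun i => Φ ω (A i)) ∂P) *
        expNeg (∫⁻ z, (1 - expNeg (SimpleFunc.eapprox g n z)) ∂Λ) := fun n =>
    h.lintegral_mul_expNeg_simpleFunc A hA hd hH _
      (fun i z hz => le_antisymm ((hle n z).trans (hgA i z hz).le) zero_le)
  simp_rw [h4]
  exact ENNReal.Tendsto.const_mul ((continuous_expNeg.tendsto _).comp h2)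
    (Or.inr (hHint.trans_lt ENNReal.one_lt_top).ne)

end IsPoissonPointProcess

/-! ### Truncated exponential series and the joint density of two distances -/

/-- The truncated exponential series `∑_{i < m} zⁱ / i!`. -/
noncomputable def expTrunc (m : ℕ) (z : ℝ) : ℝ := ∑ i ∈ Finset.range m, z ^ i / i.factorial

/-- `∑_{i < l} wⁱ / i! ∑_{j < k - i} (W - w)ʲ / j!`. Multiplied by `e^{-W}`, this is the probability
that a unit rate Poisson process has fewer than `l` points in `[0, w]` and fewer than `k` points
in `[0, W]`. -/
noncomputable def jointTrunc (l k : ℕ) (W w : ℝ) : ℝ :=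
  ∑ i ∈ Finset.range l, w ^ i / i.factorial * expTrunc (k - i) (W - w)

lemma expTrunc_succ (m : ℕ) (z : ℝ) : expTrunc (m + 1) z = expTrunc m z + z ^ m / m.factorial :=
  Finset.sum_range_succ _ _

lemma expTrunc_nonneg (m : ℕ) {z : ℝ} (hz : 0 ≤ z) : 0 ≤ expTrunc m z :=
  Finset.sum_nonneg fun i _ => by positivity

lemma expTrunc_zero_right {m : ℕ} (hm : m ≠ 0) : expTrunc m 0 = 1 := by
  obtain ⟨m, rfl⟩ := Nat.exists_eq_succ_of_ne_zero hm
  simp [expTrunc, Finset.sum_range_succ']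

lemma hasDerivAt_pow_div_factorial (m : ℕ) (z : ℝ) :
    HasDerivAt (fun z : ℝ => z ^ (m + 1) / (m + 1).factorial) (z ^ m / m.factorial) z := by
  have h := (hasDerivAt_pow (m + 1) z).div_const ((m + 1).factorial : ℝ)
  refine h.congr_deriv ?_
  have : (m.factorial : ℝ) ≠ 0 := by positivity
  have : (m + 1 : ℝ) ≠ 0 := by positivity
  rw [Nat.factorial_succ]
  push_cast
  field_simp

lemma hasDerivAt_expTrunc (m : ℕ) (z : ℝ) : HasDerivAt (expTrunc m) (expTrunc (m - 1) z) z := by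
  induction m with
  | zero =>
    have : expTrunc 0 = fun _ => 0 := by ext z; simp [expTrunc]
    rw [this]
    exact hasDerivAt_const z 0
  | succ m ih =>
    have h1 : expTrunc (m + 1) = fun z => expTrunc m z + z ^ m / m.factorial := by
      ext z; exact expTrunc_succ m z
    rw [h1, Nat.add_sub_cancel]
    cases m with
    | zero =>
      have : (fun z : ℝ => expTrunc 0 z + z ^ 0 / ((0 : ℕ).factorial : ℝ)) = fun _ => 1 := by
        ext z; simp [expTrunc]
      rw [this]
      simpa [expTrunc] using hasDerivAt_const z (1 : ℝ)
    | succ m =>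
      rw [expTrunc_succ m z]
      exact ih.add (hasDerivAt_pow_div_factorial m z)

/-- The Gamma density is minus the derivative of its survival function. -/
lemma hasDerivAt_exp_neg_mul_expTrunc (m : ℕ) (z : ℝ) :
    HasDerivAt (fun z => -(Real.exp (-z) * expTrunc (m + 1) z))
      (Real.exp (-z) * (z ^ m / m.factorial)) z := by
  have h1 : HasDerivAt (fun z : ℝ => Real.exp (-z)) (Real.exp (-z) * -1) z :=
    (hasDerivAt_neg z).exp
  have h := (h1.mul (hasDerivAt_expTrunc (m + 1) z)).neg
  refine h.congr_deriv ?_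
  rw [Nat.add_sub_cancel, expTrunc_succ]
  ring

lemma tendsto_exp_neg_mul_expTrunc (m : ℕ) :
    Tendsto (fun z => -(Real.exp (-z) * expTrunc m z)) atTop (𝓝 0) := by
  have h : Tendsto (fun z : ℝ => ∑ i ∈ Finset.range m, z ^ i * Real.exp (-z) / i.factorial) atTop
      (𝓝 (∑ i ∈ Finset.range m, 0 / (i.factorial : ℝ))) :=
    tendsto_finsetSum _ fun i _ => (Real.tendsto_pow_mul_exp_neg_atTop_nhds_zero i).div_const _
  have h2 := h.neg
  simp only [zero_div, Finset.sum_const_zero, neg_zero] at h2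
  refine h2.congr fun z => ?_
  rw [expTrunc, Finset.mul_sum]
  congr 1
  exact Finset.sum_congr rfl fun i _ => by ring

/-- The derivative of the double sum telescopes. -/
lemma hasDerivAt_jointTrunc (l k : ℕ) (W w : ℝ) :
    HasDerivAt (jointTrunc (l + 1) k W)
      (-(w ^ l / l.factorial * expTrunc (k - (l + 1)) (W - w))) w := by
  have hT : ∀ m, HasDerivAt (fun w => expTrunc m (W - w)) (-expTrunc (m - 1) (W - w)) w := by
    intro m
    exact ((hasDerivAt_expTrunc m (W - w)).comp w ((hasDerivAt_id w).const_sub W)).congr_deriv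
      (by simp)
  have hS : ∀ l, jointTrunc (l + 1) k W = fun w => jointTrunc l k W w +
      w ^ l / l.factorial * expTrunc (k - l) (W - w) := by
    intro l; ext w; exact Finset.sum_range_succ _ _
  induction l with
  | zero =>
    have : jointTrunc (0 + 1) k W = fun w => expTrunc k (W - w) := by
      ext w; simp [jointTrunc]
    rw [this]
    simpa using hT k
  | succ l ih =>
    rw [hS (l + 1)]
    refine (ih.add ((hasDerivAt_pow_div_factorial l w).mul (hT (k - (l + 1))))).congr_deriv ?_
    rw [Nat.sub_sub]
    ring

lemma jointTrunc_self {l k : ℕ} (hlk : l < k) (W : ℝ) : jointTrunc l k W W = expTrunc l W := by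
  refine Finset.sum_congr rfl fun i hi => ?_
  rw [sub_self, expTrunc_zero_right, mul_one]
  have := Finset.mem_range.1 hi
  omega

lemma lintegral_Ioi_of_hasDerivAt_of_nonneg {g g' : ℝ → ℝ} {a b : ℝ}
    (hderiv : ∀ x, HasDerivAt g (g' x) x) (hpos : ∀ x ∈ Ioi a, 0 ≤ g' x)
    (hg : Tendsto g atTop (𝓝 b)) :
    ∫⁻ x in Ioi a, ENNReal.ofReal (g' x) = ENNReal.ofReal (b - g a) := by
  rw [← integral_Ioi_of_hasDerivAt_of_nonneg' (fun x _ => hderiv x) hpos hg,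
    ofReal_integral_eq_lintegral_ofReal
      (integrableOn_Ioi_deriv_of_nonneg' (fun x _ => hderiv x) hpos hg)]
  exact (ae_restrict_iff' measurableSet_Ioi).2 (ae_of_all _ hpos)

lemma lintegral_Ioc_of_hasDerivAt_of_nonneg {g g' : ℝ → ℝ} {a b : ℝ} (hab : a ≤ b)
    (hderiv : ∀ x, HasDerivAt g (g' x) x) (hpos : ∀ x ∈ Ioc a b, 0 ≤ g' x)
    (hcont : Continuous g') :
    ∫⁻ x in Ioc a b, ENNReal.ofReal (g' x) = ENNReal.ofReal (g b - g a) := by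
  rw [← intervalIntegral.integral_eq_sub_of_hasDerivAt (fun x _ => hderiv x)
    (hcont.intervalIntegrable a b), intervalIntegral.integral_of_le hab,
    ofReal_integral_eq_lintegral_ofReal]
  · exact hcont.integrableOn_Ioc
  · exact (ae_restrict_iff' measurableSet_Ioc).2 (ae_of_all _ hpos)

lemma measurable_jointDistancePDF (lam : ℝ) (l k : ℕ) :
    Measurable fun r : ℝ × ℝ => jointDistancePDF lam l k r.1 r.2 := by
  unfold jointDistancePDF
  refine Measurable.ite ?_ (by fun_prop) measurable_const
  exact (measurableSet_le measurable_const measurable_fst).inter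
    (measurableSet_le measurable_fst measurable_snd)

lemma hasDerivAt_const_mul_sq (c u : ℝ) : HasDerivAt (fun u : ℝ => c * u ^ 2) (2 * c * u) u := by
  refine ((hasDerivAt_pow 2 u).const_mul c).congr_deriv ?_
  simp; ring

lemma continuous_expTrunc (m : ℕ) : Continuous (expTrunc m) :=
  continuous_iff_continuousAt.2 fun z => (hasDerivAt_expTrunc m z).continuousAt

/-- Mass of a quadrant under the joint density of two distances. -/
lemma lintegral_jointDistancePDF_Ioi_prod_Ioi {lam : ℝ} (hlam : 0 < lam) {l k : ℕ} (hl : 1 ≤ l)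
    (hlk : l < k) {x y : ℝ} (hx : 0 ≤ x) (hxy : x ≤ y) :
    ∫⁻ r in Ioi x ×ˢ Ioi y, ENNReal.ofReal (jointDistancePDF lam l k r.1 r.2) =
      ENNReal.ofReal (Real.exp (-(Real.pi * lam * y ^ 2)) *
        jointTrunc l k (Real.pi * lam * y ^ 2) (Real.pi * lam * x ^ 2)) := by
  obtain ⟨l, rfl⟩ := Nat.exists_eq_add_of_le' hl
  obtain ⟨m, rfl⟩ : ∃ m, k = l + 1 + m + 1 := ⟨k - l - 2, by omega⟩
  obtain ⟨c, hc⟩ : ∃ c, c = Real.pi * lam := ⟨_, rfl⟩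
  have hc0 : 0 < c := by rw [hc]; positivity
  rw [← hc]
  have hsub1 : l + 1 + m + 1 - (l + 1) - 1 = m := by omega
  have hsub2 : l + 1 + m + 1 - (l + 1) = m + 1 := by omega
  -- the density factors as a Gamma density in `c u²` and one in `c (v² - u²)`
  have hfac : ∀ u v : ℝ, 0 ≤ u → u ≤ v → jointDistancePDF lam (l + 1) (l + 1 + m + 1) u v =
      2 * c * u * ((c * u ^ 2) ^ l / l.factorial) * Real.exp (-(c * u ^ 2)) *
      (Real.exp (-(c * (v ^ 2 - u ^ 2))) * ((c * (v ^ 2 - u ^ 2)) ^ m / m.factorial) *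
        (2 * c * v)) := by
    intro u v hu huv
    have he : Real.exp (-(Real.pi * v ^ 2 * lam)) =
        Real.exp (-(c * u ^ 2)) * Real.exp (-(c * (v ^ 2 - u ^ 2))) := by
      rw [← Real.exp_add]; congr 1; rw [hc]; ring
    have hcc : lam * Real.pi = c := by rw [hc]; ring
    rw [jointDistancePDF, if_pos ⟨hu, huv⟩, hsub1, he, hcc, Nat.add_sub_cancel,
      show 2 * (l + 1) - 1 = 2 * l + 1 by omega, mul_pow c (v ^ 2 - u ^ 2), mul_pow c (u ^ 2)]
    field_simp
    ring
  have hinner : ∀ u ∈ Ioi x, ∫⁻ v in Ioi y,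
      ENNReal.ofReal (jointDistancePDF lam (l + 1) (l + 1 + m + 1) u v) =
      ENNReal.ofReal (2 * c * u * ((c * u ^ 2) ^ l / l.factorial) *
        (Real.exp (-(c * max u y ^ 2)) * expTrunc (m + 1) (c * (max u y ^ 2 - u ^ 2)))) := by
    intro u hux
    have hu : 0 ≤ u := hx.trans (le_of_lt hux)
    have h1 : ∫⁻ v in Ioi y, ENNReal.ofReal (jointDistancePDF lam (l + 1) (l + 1 + m + 1) u v) =
        ∫⁻ v in Ioi (max u y), ENNReal.ofReal
          (2 * c * u * ((c * u ^ 2) ^ l / l.factorial) * Real.exp (-(c * u ^ 2)) *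
          (Real.exp (-(c * (v ^ 2 - u ^ 2))) * ((c * (v ^ 2 - u ^ 2)) ^ m / m.factorial) *
            (2 * c * v))) := by
      rw [← lintegral_indicator measurableSet_Ioi, ← lintegral_indicator measurableSet_Ioi]
      refine lintegral_congr_ae ?_
      have hne : ∀ᵐ v : ℝ, v ≠ u := by simp [ae_iff]
      filter_upwards [hne] with v hv
      rcases lt_or_gt_of_ne hv with hvu | hvu
      · have h2 : v ∉ Ioi (max u y) := fun h => absurd ((le_max_left u y).trans_lt h) hvu.not_gt
        rw [indicator_of_notMem h2, indicator_apply]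
        simp [jointDistancePDF, hvu.not_ge]
      · have h3 : v ∈ Ioi y ↔ v ∈ Ioi (max u y) := by simp [hvu]
        by_cases h : v ∈ Ioi y
        · rw [indicator_of_mem h, indicator_of_mem (h3.1 h), hfac u v hu hvu.le]
        · rw [indicator_of_notMem h, indicator_of_notMem (fun h' => h (h3.2 h'))]
    have hd : ∀ v, HasDerivAt (fun v => 2 * c * u * ((c * u ^ 2) ^ l / l.factorial) *
        Real.exp (-(c * u ^ 2)) * -(Real.exp (-(c * (v ^ 2 - u ^ 2))) *
          expTrunc (m + 1) (c * (v ^ 2 - u ^ 2))))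
        (2 * c * u * ((c * u ^ 2) ^ l / l.factorial) * Real.exp (-(c * u ^ 2)) *
          (Real.exp (-(c * (v ^ 2 - u ^ 2))) * ((c * (v ^ 2 - u ^ 2)) ^ m / m.factorial) *
            (2 * c * v))) v := by
      intro v
      have h2 : HasDerivAt (fun v : ℝ => c * (v ^ 2 - u ^ 2)) (2 * c * v) v := by
        simp_rw [mul_sub]
        exact (hasDerivAt_const_mul_sq c v).sub_const _
      exact ((hasDerivAt_exp_neg_mul_expTrunc m (c * (v ^ 2 - u ^ 2))).comp v h2).const_mul _
    rw [h1, lintegral_Ioi_of_hasDerivAt_of_nonneg (b := 0) hd]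
    · congr 1
      have he : Real.exp (-(c * max u y ^ 2)) =
        Real.exp (-(c * u ^ 2)) * Real.exp (-(c * (max u y ^ 2 - u ^ 2))) := by
        rw [← Real.exp_add]; congr 1; ring
      rw [he]; ring
    · intro v hv
      have huv : u ≤ v := (le_max_left u y).trans (le_of_lt hv)
      have : 0 ≤ v := hu.trans huv
      have : 0 ≤ v ^ 2 - u ^ 2 := by nlinarith
      positivity
    · have h3 : Tendsto (fun v : ℝ => c * (v ^ 2 - u ^ 2)) atTop atTop :=
        (tendsto_atTop_add_const_right _ _ (tendsto_pow_atTop two_ne_zero)).const_mul_atTop hc0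
      simpa using ((tendsto_exp_neg_mul_expTrunc (m + 1)).comp h3).const_mul
        (2 * c * u * ((c * u ^ 2) ^ l / l.factorial) * Real.exp (-(c * u ^ 2)))
  have hm := (measurable_jointDistancePDF lam (l + 1) (l + 1 + m + 1)).ennreal_ofReal
  rw [Measure.volume_eq_prod, setLIntegral_prod _ hm.aemeasurable,
    setLIntegral_congr_fun measurableSet_Ioi hinner, ← Ioc_union_Ioi_eq_Ioi hxy,
    lintegral_union measurableSet_Ioi (Set.Ioc_disjoint_Ioi le_rfl)]
  have hd : ∀ u, HasDerivAt (fun u => -(Real.exp (-(c * y ^ 2)) *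
      jointTrunc (l + 1) (l + 1 + m + 1) (c * y ^ 2) (c * u ^ 2)))
      (2 * c * u * ((c * u ^ 2) ^ l / l.factorial) *
        (Real.exp (-(c * y ^ 2)) * expTrunc (m + 1) (c * (y ^ 2 - u ^ 2)))) u := by
    intro u
    refine ((((hasDerivAt_jointTrunc l (l + 1 + m + 1) (c * y ^ 2) (c * u ^ 2)).comp u
      (hasDerivAt_const_mul_sq c u)).const_mul (Real.exp (-(c * y ^ 2)))).neg).congr_deriv ?_
    rw [hsub2, mul_sub]
    ring
  have hpos : ∀ u ∈ Icc x y, 0 ≤ 2 * c * u * ((c * u ^ 2) ^ l / l.factorial) *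
      (Real.exp (-(c * y ^ 2)) * expTrunc (m + 1) (c * (y ^ 2 - u ^ 2))) := by
    intro u hu
    have h0 : 0 ≤ u := hx.trans hu.1
    have h1 : 0 ≤ y ^ 2 - u ^ 2 := by nlinarith [hu.2]
    have h2 := expTrunc_nonneg (m + 1) (mul_nonneg hc0.le h1)
    positivity
  have hcont : Continuous fun u => 2 * c * u * ((c * u ^ 2) ^ l / l.factorial) *
      (Real.exp (-(c * y ^ 2)) * expTrunc (m + 1) (c * (y ^ 2 - u ^ 2))) := by
    have := continuous_expTrunc (m + 1)
    fun_prop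
  have hA : ∫⁻ u in Ioc x y, ENNReal.ofReal (2 * c * u * ((c * u ^ 2) ^ l / l.factorial) *
        (Real.exp (-(c * max u y ^ 2)) * expTrunc (m + 1) (c * (max u y ^ 2 - u ^ 2)))) =
      ENNReal.ofReal (-(Real.exp (-(c * y ^ 2)) *
        jointTrunc (l + 1) (l + 1 + m + 1) (c * y ^ 2) (c * y ^ 2)) -
        -(Real.exp (-(c * y ^ 2)) *
          jointTrunc (l + 1) (l + 1 + m + 1) (c * y ^ 2) (c * x ^ 2))) := by
    rw [← lintegral_Ioc_of_hasDerivAt_of_nonneg hxy hd (fun u hu => hpos u ⟨hu.1.le, hu.2⟩) hcont]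
    refine setLIntegral_congr_fun measurableSet_Ioc fun u hu => ?_
    simp only [max_eq_right hu.2]
  have hB : ∫⁻ u in Ioi y, ENNReal.ofReal (2 * c * u * ((c * u ^ 2) ^ l / l.factorial) *
        (Real.exp (-(c * max u y ^ 2)) * expTrunc (m + 1) (c * (max u y ^ 2 - u ^ 2)))) =
      ENNReal.ofReal (0 - -(Real.exp (-(c * y ^ 2)) * expTrunc (l + 1) (c * y ^ 2))) := by
    rw [← lintegral_Ioi_of_hasDerivAt_of_nonneg
        (g := fun u => -(Real.exp (-(c * u ^ 2)) * expTrunc (l + 1) (c * u ^ 2)))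
        (g' := fun u => Real.exp (-(c * u ^ 2)) * ((c * u ^ 2) ^ l / l.factorial) * (2 * c * u))]
    · refine setLIntegral_congr_fun measurableSet_Ioi fun u hu => ?_
      simp only [max_eq_left (le_of_lt (mem_Ioi.1 hu)), sub_self, mul_zero,
        expTrunc_zero_right (Nat.succ_ne_zero m), mul_one]
      congr 1; ring
    · intro u
      exact HasDerivAt.comp (h₂ := fun z => -(Real.exp (-z) * expTrunc (l + 1) z)) u
        (hasDerivAt_exp_neg_mul_expTrunc l (c * u ^ 2)) (hasDerivAt_const_mul_sq c u)
    · intro u hu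
      have : 0 ≤ u := (hx.trans hxy).trans (le_of_lt hu)
      positivity
    · exact (tendsto_exp_neg_mul_expTrunc (l + 1)).comp
        ((tendsto_pow_atTop two_ne_zero).const_mul_atTop hc0)
  rw [hA, hB, jointTrunc_self hlk, ← ENNReal.ofReal_add]
  · congr 1; ring
  · rw [← jointTrunc_self hlk, ← intervalIntegral.integral_eq_sub_of_hasDerivAt (fun u _ => hd u)
      (hcont.intervalIntegrable x y)]
    exact intervalIntegral.integral_nonneg hxy hpos
  · have := expTrunc_nonneg (l + 1) (mul_nonneg hc0.le (sq_nonneg y))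
    rw [zero_sub, neg_neg]
    positivity

/-! ### Distances to the nearest points of a locally finite configuration -/

/-- The Euclidean plane. -/
abbrev Plane : Type := EuclideanSpace ℝ (Fin 2)

/-- The distance from the origin to the `j`-th nearest point of the configuration with counting
measure `ν`. -/
noncomputable def nthDist (ν : Measure Plane) (j : ℕ) : ℝ :=
  sInf {r : ℝ | 0 ≤ r ∧ (j : ℝ≥0∞) ≤ ν (Metric.closedBall 0 r)}

lemma bddBelow_nthDist (ν : Measure Plane) (j : ℕ) :
    BddBelow {r : ℝ | 0 ≤ r ∧ (j : ℝ≥0∞) ≤ ν (Metric.closedBall 0 r)} := ⟨0, fun _ h => h.1⟩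

lemma nthDist_nonneg (ν : Measure Plane) (j : ℕ) : 0 ≤ nthDist ν j :=
  Real.sInf_nonneg fun _ h => h.1

lemma exists_natCast_le_closedBall {ν : Measure Plane} (hinf : ν univ = ∞) (j : ℕ) :
    ∃ n : ℕ, (j : ℝ≥0∞) ≤ ν (Metric.closedBall 0 n) := by
  have h1 : Tendsto (fun n : ℕ => ν (Metric.closedBall 0 (n : ℝ))) atTop (𝓝 ∞) := by
    rw [← hinf, ← Metric.iUnion_closedBall_nat (0 : Plane)]
    exact tendsto_measure_iUnion_atTop fun a b hab =>
      Metric.closedBall_subset_closedBall (by exact_mod_cast hab)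
  obtain ⟨n, hn⟩ := (h1.eventually (lt_mem_nhds (ENNReal.natCast_lt_top j))).exists
  exact ⟨n, hn.le⟩

/-- The `j`-th distance exceeds `r` iff fewer than `j` points lie in the closed ball of radius `r`.
Right continuity of the count, hence local finiteness, is needed for one direction. -/
lemma lt_nthDist_iff {ν : Measure Plane} (hfin : ∀ r, ν (Metric.closedBall 0 r) ≠ ∞)
    (hinf : ν univ = ∞) {j : ℕ} (hj : j ≠ 0) (r : ℝ) :
    r < nthDist ν j ↔ ν (Metric.closedBall 0 r) < j := by
  constructor
  · intro h
    by_contra! hc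
    rcases lt_or_ge r 0 with hr | hr
    · rw [Metric.closedBall_eq_empty.2 hr, measure_empty] at hc
      exact hj (by exact_mod_cast le_antisymm hc zero_le)
    · exact absurd h (csInf_le (bddBelow_nthDist ν j) ⟨hr, hc⟩).not_gt
  · intro h
    rcases lt_or_ge r 0 with hr | hr
    · exact hr.trans_le (nthDist_nonneg ν j)
    have hI : ⋂ n : ℕ, Metric.closedBall (0 : Plane) (r + 1 / ((n : ℝ) + 1)) =
        Metric.closedBall 0 r := by
      ext z
      simp only [mem_iInter, mem_closedBall_zero_iff]
      refine ⟨fun hz => ?_, fun hz n => hz.trans (by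
        have : (0 : ℝ) < 1 / ((n : ℝ) + 1) := by positivity
        linarith)⟩
      have : Tendsto (fun n : ℕ => r + 1 / ((n : ℝ) + 1)) atTop (𝓝 (r + 0)) :=
        tendsto_one_div_add_atTop_nhds_zero_nat.const_add r
      rw [add_zero] at this
      exact ge_of_tendsto' this hz
    have hanti : Antitone fun n : ℕ => Metric.closedBall (0 : Plane) (r + 1 / ((n : ℝ) + 1)) :=
      fun a b hab => Metric.closedBall_subset_closedBall (by
        have := Nat.one_div_le_one_div (α := ℝ) hab
        linarith)
    have h1 := tendsto_measure_iInter_atTop (μ := ν)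
      (fun n => (Metric.isClosed_closedBall.measurableSet.nullMeasurableSet)) hanti
      ⟨0, hfin _⟩
    rw [hI] at h1
    obtain ⟨n, hn⟩ := (h1.eventually (gt_mem_nhds h)).exists
    have hpos : (0 : ℝ) < 1 / ((n : ℝ) + 1) := by positivity
    obtain ⟨N, hN⟩ := exists_natCast_le_closedBall hinf j
    refine (lt_add_of_pos_right r hpos).trans_le
      (le_csInf ⟨N, Nat.cast_nonneg N, hN⟩ fun s hs => ?_)
    by_contra! hc
    exact absurd (hs.2.trans (measure_mono (Metric.closedBall_subset_closedBall hc.le))) hn.not_ge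

lemma nthDist_le_nthDist {ν : Measure Plane} (hinf : ν univ = ∞) {i j : ℕ} (hij : i ≤ j) :
    nthDist ν i ≤ nthDist ν j := by
  obtain ⟨N, hN⟩ := exists_natCast_le_closedBall hinf j
  refine csInf_le_csInf (bddBelow_nthDist ν i) ⟨N, Nat.cast_nonneg N, hN⟩ fun r hr => ⟨hr.1, ?_⟩
  exact (by exact_mod_cast hij : (i : ℝ≥0∞) ≤ j).trans hr.2

lemma measurable_nthDist (j : ℕ) : Measurable fun ν : Measure Plane => nthDist ν j := by
  have hB : ∀ r : ℝ, Measurable fun ν : Measure Plane => ν (Metric.closedBall 0 r) := fun r =>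
    Measure.measurable_coe Metric.isClosed_closedBall.measurableSet
  refine measurable_of_Iio fun a => ?_
  -- if no disc contains `j` points, the infimum over the empty set is `0`
  have h : (fun ν : Measure Plane => nthDist ν j) ⁻¹' Iio a =
      (⋃ q : ℚ, {ν | (0 ≤ (q : ℝ) ∧ (q : ℝ) < a) ∧ (j : ℝ≥0∞) ≤ ν (Metric.closedBall 0 (q : ℝ))}) ∪
      {ν | (∀ n : ℕ, ν (Metric.closedBall 0 (n : ℝ)) < (j : ℝ≥0∞)) ∧ 0 < a} := by
    ext ν
    simp only [mem_preimage, mem_Iio, mem_union, mem_iUnion, mem_ofPred_eq]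
    constructor
    · intro h
      by_cases hne : {r : ℝ | 0 ≤ r ∧ (j : ℝ≥0∞) ≤ ν (Metric.closedBall 0 r)}.Nonempty
      · obtain ⟨r, hr, hra⟩ := exists_lt_of_csInf_lt hne h
        obtain ⟨q, hrq, hqa⟩ := exists_rat_btwn hra
        exact Or.inl ⟨q, ⟨hr.1.trans hrq.le, hqa⟩,
          hr.2.trans (measure_mono (Metric.closedBall_subset_closedBall hrq.le))⟩
      · refine Or.inr ⟨fun n => ?_, (nthDist_nonneg ν j).trans_lt h⟩
        by_contra! hc
        exact hne ⟨n, Nat.cast_nonneg n, hc⟩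
    · rintro (⟨q, ⟨hq0, hqa⟩, hq⟩ | ⟨h, ha⟩)
      · exact (csInf_le (bddBelow_nthDist ν j) ⟨hq0, hq⟩).trans_lt hqa
      · have he : {r : ℝ | 0 ≤ r ∧ (j : ℝ≥0∞) ≤ ν (Metric.closedBall 0 r)} = ∅ := by
          refine eq_empty_of_forall_notMem fun r hr => ?_
          obtain ⟨n, hn⟩ := exists_nat_ge r
          exact absurd (hr.2.trans (measure_mono (Metric.closedBall_subset_closedBall hn)))
            (h n).not_ge
        rwa [nthDist, he, Real.sInf_empty]
  rw [h]
  refine (MeasurableSet.iUnion fun q => ?_).union ?_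
  · exact (MeasurableSet.const _).inter (measurableSet_le measurable_const (hB _))
  · have h2 : MeasurableSet {ν : Measure Plane |
        ∀ n : ℕ, ν (Metric.closedBall 0 (n : ℝ)) < (j : ℝ≥0∞)} := by
      rw [ofPred_forall]
      exact MeasurableSet.iInter fun n => measurableSet_lt (hB _) measurable_const
    exact h2.inter (MeasurableSet.const _)

/-! ### Two finite measures on the plane agreeing on quadrants -/

lemma ext_of_Ioi_prod_Ioi {μ ν : Measure (ℝ × ℝ)} [IsFiniteMeasure μ]
    (h : ∀ x y : ℝ, μ (Ioi x ×ˢ Ioi y) = ν (Ioi x ×ˢ Ioi y)) : μ = ν := by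
  have hgen : (inferInstance : MeasurableSpace (ℝ × ℝ)) =
      MeasurableSpace.generateFrom (image2 (· ×ˢ ·) (range Ioi) (range Ioi)) := by
    refine (generateFrom_eq_prod ?_ ?_ ?_ ?_).symm
    · rw [← borel_eq_generateFrom_Ioi]; exact (BorelSpace.measurable_eq).symm
    · rw [← borel_eq_generateFrom_Ioi]; exact (BorelSpace.measurable_eq).symm
    all_goals
      refine ⟨fun n : ℕ => Ioi (-(n : ℝ)), fun n => mem_range_self _, ?_⟩
      refine eq_univ_of_forall fun x => mem_iUnion.2 ?_
      obtain ⟨n, hn⟩ := exists_nat_gt (-x)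
      exact ⟨n, by simpa using neg_lt.1 hn⟩
  have hpi : IsPiSystem (image2 (· ×ˢ ·) (range (Ioi : ℝ → Set ℝ)) (range (Ioi : ℝ → Set ℝ))) := by
    refine IsPiSystem.prod ?_ ?_ <;> exact isPiSystem_image_Ioi univ |> fun h => by simpa using h
  refine ext_of_generate_finite _ hgen hpi ?_ ?_
  · rintro _ ⟨_, ⟨x, rfl⟩, _, ⟨y, rfl⟩, rfl⟩
    exact h x y
  · have hmono : Monotone fun n : ℕ => Ioi (-(n : ℝ)) ×ˢ Ioi (-(n : ℝ)) := fun a b hab => by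
      have : -(b : ℝ) ≤ -a := by simpa using hab
      exact prod_mono (Ioi_subset_Ioi this) (Ioi_subset_Ioi this)
    have hU : ⋃ n : ℕ, Ioi (-(n : ℝ)) ×ˢ Ioi (-(n : ℝ)) = univ := by
      refine eq_univ_of_forall fun z => mem_iUnion.2 ?_
      obtain ⟨n, hn⟩ := exists_nat_gt (max (-z.1) (-z.2))
      rw [max_lt_iff] at hn
      exact ⟨n, by constructor <;> simp <;> linarith [hn.1, hn.2]⟩
    have h1 := tendsto_measure_iUnion_atTop (μ := μ) hmono
    have h2 := tendsto_measure_iUnion_atTop (μ := ν) hmono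
    rw [hU] at h1 h2
    exact tendsto_nhds_unique h1 (h2.congr fun n => (h _ _).symm)

/-- Measures carried by `{0 < u ≤ v}` agree if they agree on the quadrants `{u > x, v > y}` with
`0 ≤ x ≤ y`. -/
lemma ext_of_Ioi_prod_Ioi_of_le {μ ν : Measure (ℝ × ℝ)} [IsFiniteMeasure μ]
    (hμ : ∀ᵐ r ∂μ, 0 < r.1 ∧ r.1 ≤ r.2) (hν : ∀ᵐ r ∂ν, 0 < r.1 ∧ r.1 ≤ r.2)
    (h : ∀ x y : ℝ, 0 ≤ x → x ≤ y → μ (Ioi x ×ˢ Ioi y) = ν (Ioi x ×ˢ Ioi y)) : μ = ν := by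
  refine ext_of_Ioi_prod_Ioi fun x y => ?_
  have key : ∀ ρ : Measure (ℝ × ℝ), (∀ᵐ r ∂ρ, 0 < r.1 ∧ r.1 ≤ r.2) →
      ρ (Ioi x ×ˢ Ioi y) = ρ (Ioi (max x 0) ×ˢ Ioi (max y (max x 0))) := by
    intro ρ hρ
    refine measure_congr ?_
    filter_upwards [hρ] with r hr
    refine propext ?_
    change (r.1 ∈ Ioi x ∧ r.2 ∈ Ioi y) ↔ (r.1 ∈ Ioi (max x 0) ∧ r.2 ∈ Ioi (max y (max x 0)))
    simp only [mem_Ioi, max_lt_iff]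
    constructor
    · rintro ⟨h1, h2⟩
      exact ⟨⟨h1, hr.1⟩, h2, h1.trans_le hr.2, hr.1.trans_le hr.2⟩
    · rintro ⟨⟨h1, _⟩, h2, _⟩
      exact ⟨h1, h2⟩
  rw [key μ hμ, key ν hν]
  exact h _ _ (le_max_right _ _) (le_max_right _ _)

/-! ### Approximating a radius from above by a grid -/

/-- The smallest point of the grid `y + ℕ / (n + 1)` that is at least `r` (for `r ≥ y`). -/
noncomputable def gridCeil (y : ℝ) (n : ℕ) (r : ℝ) : ℝ := y + ⌈(r - y) * (n + 1)⌉₊ / (n + 1)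

lemma le_gridCeil (y : ℝ) (n : ℕ) (r : ℝ) : r ≤ gridCeil y n r := by
  have h := Nat.le_ceil ((r - y) * ((n : ℝ) + 1))
  rw [← le_div_iff₀ (by positivity)] at h
  unfold gridCeil
  linarith

lemma gridCeil_le {y r : ℝ} (n : ℕ) (h : y ≤ r) : gridCeil y n r ≤ r + 1 / ((n : ℝ) + 1) := by
  have hn : (0 : ℝ) < n + 1 := by positivity
  have h1 := (Nat.ceil_lt_add_one (mul_nonneg (sub_nonneg.2 h) hn.le)).le
  have h2 : (⌈(r - y) * ((n : ℝ) + 1)⌉₊ : ℝ) / (n + 1) ≤ ((r - y) * (n + 1) + 1) / (n + 1) :=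
    div_le_div_of_nonneg_right h1 hn.le
  rw [add_div, mul_div_assoc, div_self hn.ne', mul_one] at h2
  unfold gridCeil
  linarith

lemma tendsto_gridCeil {y r : ℝ} (h : y ≤ r) : Tendsto (fun n => gridCeil y n r) atTop (𝓝 r) := by
  have h1 : Tendsto (fun n : ℕ => r + 1 / ((n : ℝ) + 1)) atTop (𝓝 (r + 0)) :=
    tendsto_one_div_add_atTop_nhds_zero_nat.const_add r
  rw [add_zero] at h1
  exact tendsto_of_tendsto_of_tendsto_of_le_of_le tendsto_const_nhds h1
    (fun n => le_gridCeil y n r) (fun n => gridCeil_le n h)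

/-- Evaluating a right-continuous process at a nonnegative random time is measurable. -/
lemma measurable_eval_of_right_continuous {Ω : Type*} [MeasurableSpace Ω] {F : Ω → ℝ → ℝ≥0∞}
    (hF : ∀ r, Measurable fun ω => F ω r)
    (hc : ∀ ω r (ρ : ℕ → ℝ), (∀ n, r ≤ ρ n) → Tendsto ρ atTop (𝓝 r) →
      Tendsto (fun n => F ω (ρ n)) atTop (𝓝 (F ω r)))
    {R : Ω → ℝ} (hR : Measurable R) (hR0 : ∀ ω, 0 ≤ R ω) : Measurable fun ω => F ω (R ω) := by
  refine ENNReal.measurable_of_tendsto (f := fun n ω => F ω (gridCeil 0 n (R ω))) (fun n => ?_)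
    (tendsto_pi_nhds.2 fun ω => hc ω _ _ (fun n => le_gridCeil 0 n _) (tendsto_gridCeil (hR0 ω)))
  have h1 : Measurable fun q : ℕ × Ω => F q.2 (0 + q.1 / ((n : ℝ) + 1)) :=
    measurable_from_prod_countable_right fun j => hF (0 + j / ((n : ℝ) + 1))
  have h2 : Measurable fun ω => (⌈(R ω - 0) * ((n : ℝ) + 1)⌉₊, ω) :=
    (Nat.measurable_ceil.comp (by fun_prop)).prodMk measurable_id
  exact h1.comp h2

lemma tendsto_setLIntegral_compl_closedBall (ν : Measure Plane) (g : Plane → ℝ≥0∞) {r : ℝ}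
    {ρ : ℕ → ℝ} (hρ : ∀ n, r ≤ ρ n) (hlim : Tendsto ρ atTop (𝓝 r)) :
    Tendsto (fun n => ∫⁻ z in (Metric.closedBall 0 (ρ n))ᶜ, g z ∂ν) atTop
      (𝓝 (∫⁻ z in (Metric.closedBall 0 r)ᶜ, g z ∂ν)) := by
  have hm : ∀ r, MeasurableSet (Metric.closedBall (0 : Plane) r)ᶜ := fun r =>
    Metric.isClosed_closedBall.measurableSet.compl
  simp_rw [← withDensity_apply g (hm _)]
  have hU : ⋃ n : ℕ, (Metric.closedBall (0 : Plane) (r + 1 / ((n : ℝ) + 1)))ᶜ =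
      (Metric.closedBall 0 r)ᶜ := by
    ext z
    simp only [mem_iUnion, mem_compl_iff, mem_closedBall_zero_iff, not_le]
    constructor
    · rintro ⟨n, hn⟩
      have : (0 : ℝ) < 1 / ((n : ℝ) + 1) := by positivity
      linarith
    · intro h
      obtain ⟨n, hn⟩ := exists_nat_one_div_lt (sub_pos.2 h)
      exact ⟨n, by linarith⟩
  have hmono : Monotone fun n : ℕ => (Metric.closedBall (0 : Plane) (r + 1 / ((n : ℝ) + 1)))ᶜ :=
    fun a b hab => compl_subset_compl.2 (Metric.closedBall_subset_closedBall (by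
      have := Nat.one_div_le_one_div (α := ℝ) hab
      linarith))
  have h1 := tendsto_measure_iUnion_atTop (μ := ν.withDensity g) hmono
  rw [hU] at h1
  refine tendsto_order.2 ⟨fun a ha => ?_, fun a ha => Eventually.of_forall fun n => ?_⟩
  · obtain ⟨i, hi⟩ := (h1.eventually (lt_mem_nhds ha)).exists
    have hpos : r < r + 1 / ((i : ℝ) + 1) := lt_add_of_pos_right r (by positivity)
    filter_upwards [hlim.eventually (gt_mem_nhds hpos)] with n hn
    exact hi.trans_le (measure_mono
      (compl_subset_compl.2 (Metric.closedBall_subset_closedBall hn.le)))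
  · exact (measure_mono
      (compl_subset_compl.2 (Metric.closedBall_subset_closedBall (hρ n)))).trans_lt ha

/-! ### Homogeneous Poisson point processes in the plane -/

instance sigmaFinite_ofReal_smul (lam : ℝ) :
    SigmaFinite (ENNReal.ofReal lam • (volume : Measure Plane)) :=
  inferInstanceAs (SigmaFinite (lam.toNNReal • (volume : Measure Plane)))

lemma smul_volume_closedBall {lam : ℝ} (hlam : 0 < lam) {r : ℝ} (hr : 0 ≤ r) :
    (ENNReal.ofReal lam • (volume : Measure Plane)) (Metric.closedBall 0 r) =
      ENNReal.ofReal (Real.pi * lam * r ^ 2) := by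
  rw [Measure.smul_apply, smul_eq_mul, EuclideanSpace.volume_closedBall_fin_two,
    ← ENNReal.ofReal_pow hr, ← ENNReal.ofReal_mul (by positivity), ← ENNReal.ofReal_mul hlam.le]
  congr 1; ring

namespace IsPoissonPointProcess

variable {Ω : Type*} [MeasurableSpace Ω] {P : Measure Ω} {Φ : Ω → Measure Plane} {lam : ℝ}

lemma measurable_nthDist (h : IsPoissonPointProcess P Φ (ENNReal.ofReal lam • volume)) (j : ℕ) :
    Measurable fun ω => nthDist (Φ ω) j :=
  (_root_.measurable_nthDist j).comp h.measurable

lemma ae_count_ne_top {E : Type*} [MeasurableSpace E] {Φ : Ω → Measure E} {Λ : Measure E}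
    (h : IsPoissonPointProcess P Φ Λ) {C : Set E} (hC : MeasurableSet C) (hfin : Λ C ≠ ∞) :
    ∀ᵐ ω ∂P, Φ ω C ≠ ∞ := by
  have h1 := h.poisson_count C hC hfin
  have h2 : ∀ᵐ z ∂(P.map fun ω => Φ ω C), z ≠ ∞ := by
    rw [h1]
    refine (ae_map_iff (by fun_prop) ?_).2 (ae_of_all _ fun n => ENNReal.natCast_ne_top n)
    exact (measurableSet_singleton ∞).compl
  exact ae_of_ae_map (h.measurable_count C hC).aemeasurable h2

lemma ae_count_eq_zero {E : Type*} [MeasurableSpace E] {Φ : Ω → Measure E} {Λ : Measure E}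
    (h : IsPoissonPointProcess P Φ Λ) {C : Set E} (hC : MeasurableSet C) (h0 : Λ C = 0) :
    ∀ᵐ ω ∂P, Φ ω C = 0 := by
  have h1 := h.poisson_count C hC (by simp [h0])
  have h2 : ∀ᵐ z ∂(P.map fun ω => Φ ω C), z = 0 := by
    rw [h1, h0]
    refine (ae_map_iff (by fun_prop) (measurableSet_singleton 0)).2 ?_
    have h3 : poissonMeasure (0 : ℝ≥0) {0}ᶜ = 0 := by
      rw [prob_compl_eq_zero_iff (measurableSet_singleton _), poissonMeasure_singleton]
      simp
    rw [ENNReal.toNNReal_zero, ae_iff]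
    refine measure_mono_null (fun n (hn : ¬((n : ℝ≥0∞) = 0)) => ?_) h3
    exact fun h0 : n = 0 => hn (by simp [h0])
  exact ae_of_ae_map (h.measurable_count C hC).aemeasurable h2

lemma ae_closedBall_ne_top (h : IsPoissonPointProcess P Φ (ENNReal.ofReal lam • volume))
    (hlam : 0 < lam) : ∀ᵐ ω ∂P, ∀ r, Φ ω (Metric.closedBall 0 r) ≠ ∞ := by
  have h1 : ∀ n : ℕ, ∀ᵐ ω ∂P, Φ ω (Metric.closedBall 0 (n : ℝ)) ≠ ∞ := fun n =>
    h.ae_count_ne_top Metric.isClosed_closedBall.measurableSet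
      (by rw [smul_volume_closedBall hlam n.cast_nonneg]; exact ENNReal.ofReal_ne_top)
  filter_upwards [ae_all_iff.2 h1] with ω hω r
  obtain ⟨n, hn⟩ := exists_nat_ge r
  exact ((measure_mono (Metric.closedBall_subset_closedBall hn)).trans_lt (hω n).lt_top).ne

lemma ae_closedBall_zero (h : IsPoissonPointProcess P Φ (ENNReal.ofReal lam • volume))
    (hlam : 0 < lam) : ∀ᵐ ω ∂P, Φ ω (Metric.closedBall 0 0) = 0 :=
  h.ae_count_eq_zero Metric.isClosed_closedBall.measurableSet
    (by rw [smul_volume_closedBall hlam le_rfl]; simp)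

variable [IsProbabilityMeasure P]

lemma ae_univ_eq_top (h : IsPoissonPointProcess P Φ (ENNReal.ofReal lam • volume))
    (hlam : 0 < lam) : ∀ᵐ ω ∂P, Φ ω univ = ∞ := by
  have h1 := h.lintegral_expNeg_count MeasurableSet.univ 1
  have h2 : (ENNReal.ofReal lam • (volume : Measure Plane)) univ = ∞ := by
    simp [hlam]
  have h3 : 1 - expNeg 1 ≠ 0 := by
    have : expNeg 1 = ENNReal.ofReal (Real.exp (-1)) := by
      rw [← expNeg_ofReal zero_le_one, ENNReal.ofReal_one]
    rw [this]
    refine (tsub_pos_of_lt ?_).ne'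
    rw [ENNReal.ofReal_lt_one]
    simp
  rw [h2, ENNReal.mul_top h3, expNeg_top, lintegral_eq_zero_iff
    (by have := h.measurable_count _ MeasurableSet.univ; fun_prop)] at h1
  filter_upwards [h1] with ω hω
  simpa [expNeg_eq_zero] using hω

lemma ae_lt_nthDist_iff (h : IsPoissonPointProcess P Φ (ENNReal.ofReal lam • volume))
    (hlam : 0 < lam) {j : ℕ} (hj : j ≠ 0) :
    ∀ᵐ ω ∂P, ∀ r, r < nthDist (Φ ω) j ↔ Φ ω (Metric.closedBall 0 r) < j := by
  filter_upwards [h.ae_closedBall_ne_top hlam, h.ae_univ_eq_top hlam] with ω h1 h2 r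
  exact lt_nthDist_iff h1 h2 hj r

lemma ae_nthDist_pos (h : IsPoissonPointProcess P Φ (ENNReal.ofReal lam • volume))
    (hlam : 0 < lam) {j : ℕ} (hj : j ≠ 0) : ∀ᵐ ω ∂P, 0 < nthDist (Φ ω) j := by
  filter_upwards [h.ae_lt_nthDist_iff hlam hj, h.ae_closedBall_zero hlam] with ω h1 h2
  rw [h1, h2]
  exact_mod_cast Nat.pos_of_ne_zero hj

lemma ae_nthDist_le (h : IsPoissonPointProcess P Φ (ENNReal.ofReal lam • volume))
    (hlam : 0 < lam) {i j : ℕ} (hij : i ≤ j) :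
    ∀ᵐ ω ∂P, nthDist (Φ ω) i ≤ nthDist (Φ ω) j := by
  filter_upwards [h.ae_univ_eq_top hlam] with ω h1
  exact nthDist_le_nthDist h1 hij

/-- The number of points in a closed disc and in an annulus around it: probability that fewer
than `l` points lie in the disc and fewer than `k` in the larger one. -/
lemma measure_count_lt_count_lt (h : IsPoissonPointProcess P Φ (ENNReal.ofReal lam • volume))
    (hlam : 0 < lam) {l k : ℕ} {x y : ℝ} (hx : 0 ≤ x) (hxy : x ≤ y) :
    P {ω | Φ ω (Metric.closedBall 0 x) < l ∧ Φ ω (Metric.closedBall 0 y) < k} =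
      ENNReal.ofReal (Real.exp (-(Real.pi * lam * y ^ 2)) *
        jointTrunc l k (Real.pi * lam * y ^ 2) (Real.pi * lam * x ^ 2)) := by
  set Λ : Measure Plane := ENNReal.ofReal lam • volume with hΛ
  have hmB : ∀ r, MeasurableSet (Metric.closedBall (0 : Plane) r) := fun r =>
    Metric.isClosed_closedBall.measurableSet
  set B := Metric.closedBall (0 : Plane) x
  set C := Metric.closedBall (0 : Plane) y \ B with hCdef
  have hsub : B ⊆ Metric.closedBall 0 y := Metric.closedBall_subset_closedBall hxy
  have hmC : MeasurableSet C := (hmB y).diff (hmB x)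
  have hdisj : Disjoint B C := disjoint_sdiff_self_right
  have hΛB : Λ B = ENNReal.ofReal (Real.pi * lam * x ^ 2) := smul_volume_closedBall hlam hx
  have hxy2 : x ^ 2 ≤ y ^ 2 := by nlinarith
  have hW : 0 ≤ Real.pi * lam * y ^ 2 - Real.pi * lam * x ^ 2 := by
    rw [← mul_sub]
    have : 0 ≤ y ^ 2 - x ^ 2 := by linarith
    positivity
  have hΛC : Λ C = ENNReal.ofReal (Real.pi * lam * y ^ 2 - Real.pi * lam * x ^ 2) := by
    rw [hCdef, measure_sdiff hsub (hmB x).nullMeasurableSet (by rw [hΛB]; exact ENNReal.ofReal_ne_top),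
      hΛB, smul_volume_closedBall hlam (hx.trans hxy), ENNReal.ofReal_sub _ (by positivity)]
  have hind : IndepFun (fun ω => Φ ω B) (fun ω => Φ ω C) P := by
    have h1 := h.iIndepFun_count ![B, C] (by
      intro i; fin_cases i
      · exact hmB x
      · exact hmC) (by
      intro i j hij
      fin_cases i <;> fin_cases j <;> simp at hij
      · exact hdisj
      · exact hdisj.symm)
    exact h1.indepFun (i := 0) (j := 1) (by decide)
  have hmap := (indepFun_iff_map_prod_eq_prod_map_map (h.measurable_count B (hmB x)).aemeasurable
    (h.measurable_count C hmC).aemeasurable).1 hind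
  set a := (Λ B).toNNReal with ha
  set b := (Λ C).toNNReal with hb
  rw [h.poisson_count B (hmB x) (by rw [hΛB]; exact ENNReal.ofReal_ne_top),
    h.poisson_count C hmC (by rw [hΛC]; exact ENNReal.ofReal_ne_top),
    Measure.map_prod_map _ _ Measurable.of_discrete Measurable.of_discrete] at hmap
  have haR : (a : ℝ) = Real.pi * lam * x ^ 2 := by
    rw [ha, hΛB]; exact Real.coe_toNNReal _ (by positivity)
  have hbR : (b : ℝ) = Real.pi * lam * y ^ 2 - Real.pi * lam * x ^ 2 := by
    rw [hb, hΛC]; exact Real.coe_toNNReal _ hW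
  have hmS : MeasurableSet {q : ℝ≥0∞ × ℝ≥0∞ | q.1 < l ∧ q.1 + q.2 < k} :=
    (measurableSet_lt measurable_fst measurable_const).inter
      (measurableSet_lt (measurable_fst.add measurable_snd) measurable_const)
  have h1 : P {ω | Φ ω B < l ∧ Φ ω (Metric.closedBall 0 y) < k} =
      (P.map fun ω => (Φ ω B, Φ ω C)) {q | q.1 < l ∧ q.1 + q.2 < k} := by
    rw [Measure.map_apply ((h.measurable_count B (hmB x)).prodMk (h.measurable_count C hmC)) hmS]
    congr 1
    ext ω
    have : Φ ω (Metric.closedBall 0 y) = Φ ω B + Φ ω C := by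
      rw [← measure_union hdisj hmC, hCdef, union_sdiff_cancel hsub]
    simp [this]
  rw [h1, hmap, Measure.map_apply Measurable.of_discrete hmS]
  let S : Finset (ℕ × ℕ) := ((Finset.range l).sigma fun i => Finset.range (k - i)).map
    (Equiv.sigmaEquivProd ℕ ℕ).toEmbedding
  have hS : (Prod.map (fun n : ℕ => (n : ℝ≥0∞)) fun n : ℕ => (n : ℝ≥0∞)) ⁻¹'
      {q | q.1 < l ∧ q.1 + q.2 < k} = (S : Set (ℕ × ℕ)) := by
    ext ⟨i, j⟩
    have e : ((i : ℝ≥0∞) + j < k) ↔ i + j < k := by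
      rw [← Nat.cast_add, Nat.cast_lt]
    simp only [mem_preimage, Prod.map_apply, mem_ofPred_eq, Nat.cast_lt, e, S, Finset.coe_map,
      mem_image, Finset.mem_coe, Finset.mem_sigma, Finset.mem_range]
    constructor
    · rintro ⟨h1, h2⟩
      exact ⟨⟨i, j⟩, ⟨h1, by simp; omega⟩, rfl⟩
    · rintro ⟨⟨i', j'⟩, ⟨h1, h2⟩, h3⟩
      obtain ⟨rfl, rfl⟩ : i' = i ∧ j' = j := by simpa using h3
      exact ⟨h1, by simp at h2; omega⟩
  rw [hS, ← sum_measure_singleton, Finset.sum_map, Finset.sum_sigma]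
  have hterm : ∀ i j : ℕ, ((poissonMeasure a).prod (poissonMeasure b)) {(i, j)} =
      ENNReal.ofReal (Real.exp (-(Real.pi * lam * y ^ 2)) *
        ((Real.pi * lam * x ^ 2) ^ i / i.factorial *
          ((Real.pi * lam * y ^ 2 - Real.pi * lam * x ^ 2) ^ j / j.factorial))) := by
    intro i j
    rw [← singleton_prod_singleton, Measure.prod_prod, poissonMeasure_singleton,
      poissonMeasure_singleton, ← ENNReal.ofReal_mul (by positivity), haR, hbR]
    congr 1
    rw [show -(Real.pi * lam * y ^ 2) = -(Real.pi * lam * x ^ 2) +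
      -(Real.pi * lam * y ^ 2 - Real.pi * lam * x ^ 2) by ring, Real.exp_add]
    ring
  have hnn : ∀ i j : ℕ, 0 ≤ Real.exp (-(Real.pi * lam * y ^ 2)) *
        ((Real.pi * lam * x ^ 2) ^ i / i.factorial *
          ((Real.pi * lam * y ^ 2 - Real.pi * lam * x ^ 2) ^ j / j.factorial)) := by
    intro i j
    have := pow_nonneg hW j
    positivity
  refine (Finset.sum_congr rfl fun i _ => Finset.sum_congr rfl fun j _ => hterm i j).trans ?_
  simp_rw [← ENNReal.ofReal_sum_of_nonneg (fun j _ => hnn _ j)]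
  rw [← ENNReal.ofReal_sum_of_nonneg (fun i _ => Finset.sum_nonneg fun j _ => hnn i j)]
  simp only [jointTrunc, expTrunc, Finset.mul_sum]

/-- The joint law of the distances to the `l`-th and the `k`-th nearest point. -/
lemma map_nthDist_nthDist (h : IsPoissonPointProcess P Φ (ENNReal.ofReal lam • volume))
    (hlam : 0 < lam) {l k : ℕ} (hl : 1 ≤ l) (hlk : l < k) :
    P.map (fun ω => (nthDist (Φ ω) l, nthDist (Φ ω) k)) =
      (volume : Measure (ℝ × ℝ)).withDensity
        (fun r => ENNReal.ofReal (jointDistancePDF lam l k r.1 r.2)) := by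
  have hl0 : l ≠ 0 := by omega
  have hk0 : k ≠ 0 := by omega
  have hR : Measurable fun ω => (nthDist (Φ ω) l, nthDist (Φ ω) k) :=
    (h.measurable_nthDist l).prodMk (h.measurable_nthDist k)
  have : IsProbabilityMeasure (P.map (fun ω => (nthDist (Φ ω) l, nthDist (Φ ω) k))) :=
    Measure.isProbabilityMeasure_map hR.aemeasurable
  have hmS : MeasurableSet {r : ℝ × ℝ | 0 < r.1 ∧ r.1 ≤ r.2} :=
    (measurableSet_lt measurable_const measurable_fst).inter
      (measurableSet_le measurable_fst measurable_snd)
  refine ext_of_Ioi_prod_Ioi_of_le ?_ ?_ fun x y hx hxy => ?_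
  · refine (ae_map_iff hR.aemeasurable hmS).2 ?_
    filter_upwards [h.ae_nthDist_pos hlam hl0, h.ae_nthDist_le hlam hlk.le] with ω h1 h2
    exact ⟨h1, h2⟩
  · rw [ae_withDensity_iff (measurable_jointDistancePDF lam l k).ennreal_ofReal]
    refine ae_of_all _ fun r hr => ?_
    have h1 : 0 < jointDistancePDF lam l k r.1 r.2 := by
      by_contra! hc
      exact hr (ENNReal.ofReal_of_nonpos hc)
    rw [jointDistancePDF] at h1
    split_ifs at h1 with hif
    · refine ⟨lt_of_le_of_ne hif.1 fun h0 => ?_, hif.2⟩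
      rw [← h0, zero_pow (by omega : 2 * l - 1 ≠ 0)] at h1
      simp at h1
    · exact absurd h1 (lt_irrefl 0)
  · rw [withDensity_apply _ (measurableSet_Ioi.prod measurableSet_Ioi),
      lintegral_jointDistancePDF_Ioi_prod_Ioi hlam hl hlk hx hxy,
      Measure.map_apply hR (measurableSet_Ioi.prod measurableSet_Ioi),
      ← h.measure_count_lt_count_lt hlam hx hxy]
    refine measure_congr ?_
    filter_upwards [h.ae_lt_nthDist_iff hlam hl0, h.ae_lt_nthDist_iff hlam hk0] with ω h1 h2
    exact propext (and_congr (h1 x) (h2 y))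

end IsPoissonPointProcess

/-! ### The points outside the disc through the `k`-th nearest point -/

/-- The integral of `g` over the complement of the closed disc of radius `r` around the origin. -/
noncomputable def tailIntegral (g : Plane → ℝ≥0∞) (ν : Measure Plane) (r : ℝ) : ℝ≥0∞ :=
  ∫⁻ z in (Metric.closedBall 0 r)ᶜ, g z ∂ν

lemma tendsto_expNeg_tailIntegral (g : Plane → ℝ≥0∞) (ν : Measure Plane) {r : ℝ} {ρ : ℕ → ℝ}
    (hρ : ∀ n, r ≤ ρ n) (hlim : Tendsto ρ atTop (𝓝 r)) :
    Tendsto (fun n => expNeg (tailIntegral g ν (ρ n))) atTop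
      (𝓝 (expNeg (tailIntegral g ν r))) :=
  (continuous_expNeg.tendsto _).comp (tendsto_setLIntegral_compl_closedBall ν g hρ hlim)

lemma tailIntegral_eq_lintegral_indicator (g : Plane → ℝ≥0∞) (ν : Measure Plane) (r : ℝ) :
    tailIntegral g ν r = ∫⁻ z, (Metric.closedBall 0 r)ᶜ.indicator g z ∂ν :=
  (lintegral_indicator Metric.isClosed_closedBall.measurableSet.compl g).symm

namespace IsPoissonPointProcess

variable {Ω : Type*} [MeasurableSpace Ω] {P : Measure Ω} {Φ : Ω → Measure Plane} {lam : ℝ}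

lemma measurable_expNeg_tailIntegral
    (h : IsPoissonPointProcess P Φ (ENNReal.ofReal lam • volume)) {g : Plane → ℝ≥0∞}
    (hg : Measurable g) (k : ℕ) :
    Measurable fun ω => expNeg (tailIntegral g (Φ ω) (nthDist (Φ ω) k)) := by
  refine measurable_eval_of_right_continuous (F := fun ω r => expNeg (tailIntegral g (Φ ω) r))
    (fun r => ?_) (fun ω r ρ => tendsto_expNeg_tailIntegral g (Φ ω))
    (h.measurable_nthDist k) (fun ω => nthDist_nonneg _ _)
  simp_rw [tailIntegral_eq_lintegral_indicator]
  exact measurable_expNeg.comp (h.measurable_lintegral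
    (hg.indicator Metric.isClosed_closedBall.measurableSet.compl))

lemma measurable_expNeg_tailIntegral_const
    (h : IsPoissonPointProcess P Φ (ENNReal.ofReal lam • volume)) (g : Plane → ℝ≥0∞)
    (ν : Measure Plane) (k : ℕ) :
    Measurable fun ω => expNeg (tailIntegral g ν (nthDist (Φ ω) k)) :=
  measurable_eval_of_right_continuous (F := fun _ r => expNeg (tailIntegral g ν r))
    (fun _ => measurable_const) (fun _ _ _ => tendsto_expNeg_tailIntegral g ν)
    (h.measurable_nthDist k) (fun _ => nthDist_nonneg _ _)

variable [IsProbabilityMeasure P]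

/-- On the event that the `k`-th distance lies in `(b, b']`, an event determined by the points in
the disc of radius `b'`, the points outside that disc are still Poisson. -/
lemma setLIntegral_expNeg_tailIntegral_cell
    (h : IsPoissonPointProcess P Φ (ENNReal.ofReal lam • volume)) (hlam : 0 < lam) {l k : ℕ}
    (hl : l ≠ 0) (hk : k ≠ 0) {g : Plane → ℝ≥0∞} (hg : Measurable g) {x b b' : ℝ}
    (hxb : x ≤ b) (hbb' : b ≤ b') :
    ∫⁻ ω in {ω | x < nthDist (Φ ω) l ∧ b < nthDist (Φ ω) k ∧ nthDist (Φ ω) k ≤ b'},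
        expNeg (tailIntegral g (Φ ω) b') ∂P =
      ∫⁻ _ in {ω | x < nthDist (Φ ω) l ∧ b < nthDist (Φ ω) k ∧ nthDist (Φ ω) k ≤ b'},
        expNeg (tailIntegral (fun z => 1 - expNeg (g z)) (ENNReal.ofReal lam • volume) b') ∂P := by
  have hmB : ∀ r, MeasurableSet (Metric.closedBall (0 : Plane) r) := fun r =>
    Metric.isClosed_closedBall.measurableSet
  have hRl := h.measurable_nthDist l
  have hRk := h.measurable_nthDist k
  have hE : MeasurableSet
      {ω | x < nthDist (Φ ω) l ∧ b < nthDist (Φ ω) k ∧ nthDist (Φ ω) k ≤ b'} :=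
    (measurableSet_lt measurable_const hRl).inter
      ((measurableSet_lt measurable_const hRk).inter (measurableSet_le hRk measurable_const))
  set A : Fin 3 → Set Plane := ![Metric.closedBall 0 x, Metric.closedBall 0 b \ Metric.closedBall 0 x,
    Metric.closedBall 0 b' \ Metric.closedBall 0 b] with hAdef
  have hA : ∀ i, MeasurableSet (A i) := by
    intro i
    fin_cases i
    · exact hmB x
    · exact (hmB b).diff (hmB x)
    · exact (hmB b').diff (hmB b)
  have hsub1 : Metric.closedBall (0 : Plane) x ⊆ Metric.closedBall 0 b :=
    Metric.closedBall_subset_closedBall hxb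
  have hsub2 : Metric.closedBall (0 : Plane) b ⊆ Metric.closedBall 0 b' :=
    Metric.closedBall_subset_closedBall hbb'
  have hAsub : ∀ i, A i ⊆ Metric.closedBall 0 b' := by
    intro i
    fin_cases i
    · exact hsub1.trans hsub2
    · exact sdiff_subset.trans hsub2
    · exact sdiff_subset
  have d01 : Disjoint (A 0) (A 1) := disjoint_sdiff_self_right
  have d02 : Disjoint (A 0) (A 2) := disjoint_sdiff_self_right.mono_left hsub1
  have d12 : Disjoint (A 1) (A 2) := disjoint_sdiff_self_right.mono_left sdiff_subset
  have hd : Pairwise (Function.onFun Disjoint A) := by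
    intro i j hij
    fin_cases i <;> fin_cases j <;> simp at hij
    exacts [d01, d02, d01.symm, d12, d02.symm, d12.symm]
  let S : Set (Fin 3 → ℝ≥0∞) := {a | a 0 < l ∧ a 0 + a 1 < k ∧ (k : ℝ≥0∞) ≤ a 0 + a 1 + a 2}
  have hS : MeasurableSet S :=
    (measurableSet_lt (measurable_pi_apply 0) measurable_const).inter
      ((measurableSet_lt ((measurable_pi_apply 0).add (measurable_pi_apply 1))
        measurable_const).inter (measurableSet_le measurable_const
        (((measurable_pi_apply 0).add (measurable_pi_apply 1)).add (measurable_pi_apply 2))))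
  have hcount : ∀ᵐ ω ∂P, (S.indicator (fun _ => (1 : ℝ≥0∞)) fun i => Φ ω (A i)) =
      {ω | x < nthDist (Φ ω) l ∧ b < nthDist (Φ ω) k ∧ nthDist (Φ ω) k ≤ b'}.indicator
        (fun _ => (1 : ℝ≥0∞)) ω := by
    filter_upwards [h.ae_lt_nthDist_iff hlam hl, h.ae_lt_nthDist_iff hlam hk] with ω h1 h2
    have e1 : Φ ω (A 0) + Φ ω (A 1) = Φ ω (Metric.closedBall 0 b) := by
      rw [← measure_union d01 (hA 1)]
      congr 1
      exact union_sdiff_cancel hsub1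
    have e2 : Φ ω (Metric.closedBall 0 b) + Φ ω (A 2) = Φ ω (Metric.closedBall 0 b') := by
      have hdb : Disjoint (Metric.closedBall 0 b) (A 2) := disjoint_sdiff_self_right
      rw [← measure_union hdb (hA 2)]
      congr 1
      exact union_sdiff_cancel hsub2
    have hiff : (fun i => Φ ω (A i)) ∈ S ↔
        (x < nthDist (Φ ω) l ∧ b < nthDist (Φ ω) k ∧ nthDist (Φ ω) k ≤ b') := by
      change (Φ ω (A 0) < l ∧ Φ ω (A 0) + Φ ω (A 1) < k ∧
        (k : ℝ≥0∞) ≤ Φ ω (A 0) + Φ ω (A 1) + Φ ω (A 2)) ↔ _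
      rw [e1, e2, h1, h2, ← not_lt (a := b'), h2, not_lt]
      rfl
    simp only [indicator_apply]
    exact if_congr hiff rfl rfl
  have key := h.lintegral_mul_expNeg A hA hd (H := S.indicator fun _ => 1)
    (measurable_const.indicator hS) (fun a => indicator_le (fun _ _ => le_rfl) a)
    (g := (Metric.closedBall 0 b')ᶜ.indicator g) (hg.indicator (hmB b').compl)
    (fun i z hz => indicator_of_notMem (notMem_compl_iff.2 (hAsub i hz)) g)
  have hind : ∀ z, 1 - expNeg ((Metric.closedBall (0 : Plane) b')ᶜ.indicator g z) =
      (Metric.closedBall (0 : Plane) b')ᶜ.indicator (fun z => 1 - expNeg (g z)) z := by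
    intro z
    by_cases hz : z ∈ (Metric.closedBall (0 : Plane) b')ᶜ
    · rw [indicator_of_mem hz, indicator_of_mem hz]
    · rw [indicator_of_notMem hz, indicator_of_notMem hz, expNeg_zero, tsub_self]
  simp_rw [hind, ← tailIntegral_eq_lintegral_indicator] at key
  rw [lintegral_congr_ae hcount, lintegral_indicator hE, setLIntegral_one] at key
  rw [setLIntegral_const, mul_comm, ← key, ← lintegral_indicator hE]
  refine lintegral_congr_ae ?_
  filter_upwards [hcount] with ω hω
  rw [hω]
  simp only [indicator_apply]
  split_ifs <;> simp

/-- Strong Markov property of the Poisson process at the `k`-th distance, on a quadrant of values of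
the two distances. -/
lemma setLIntegral_expNeg_tailIntegral_quadrant
    (h : IsPoissonPointProcess P Φ (ENNReal.ofReal lam • volume)) (hlam : 0 < lam) {l k : ℕ}
    (hl : l ≠ 0) (hk : k ≠ 0) {g : Plane → ℝ≥0∞} (hg : Measurable g) {x y : ℝ} (hxy : x ≤ y) :
    ∫⁻ ω in {ω | x < nthDist (Φ ω) l ∧ y < nthDist (Φ ω) k},
        expNeg (tailIntegral g (Φ ω) (nthDist (Φ ω) k)) ∂P =
      ∫⁻ ω in {ω | x < nthDist (Φ ω) l ∧ y < nthDist (Φ ω) k},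
        expNeg (tailIntegral (fun z => 1 - expNeg (g z)) (ENNReal.ofReal lam • volume)
          (nthDist (Φ ω) k)) ∂P := by
  have hRl := h.measurable_nthDist l
  have hRk := h.measurable_nthDist k
  set D := {ω | x < nthDist (Φ ω) l ∧ y < nthDist (Φ ω) k} with hD
  have hDm : MeasurableSet D :=
    (measurableSet_lt measurable_const hRl).inter (measurableSet_lt measurable_const hRk)
  -- both sides are limits of the same integrals with the `k`-th distance rounded up to a grid
  have lim : ∀ F : Ω → ℝ → ℝ≥0∞, (∀ r, Measurable fun ω => F ω r) → (∀ ω r, F ω r ≤ 1) →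
      (∀ ω r (ρ : ℕ → ℝ), (∀ n, r ≤ ρ n) → Tendsto ρ atTop (𝓝 r) →
        Tendsto (fun n => F ω (ρ n)) atTop (𝓝 (F ω r))) →
      Tendsto (fun n => ∫⁻ ω in D, F ω (gridCeil y n (nthDist (Φ ω) k)) ∂P) atTop
        (𝓝 (∫⁻ ω in D, F ω (nthDist (Φ ω) k) ∂P)) := by
    intro F hF hF1 hc
    have hm : ∀ n, Measurable fun ω => F ω (gridCeil y n (nthDist (Φ ω) k)) := by
      intro n
      have h1 : Measurable fun q : ℕ × Ω => F q.2 (y + q.1 / ((n : ℝ) + 1)) :=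
        measurable_from_prod_countable_right fun j => hF (y + j / ((n : ℝ) + 1))
      have h2 : Measurable fun ω => (⌈(nthDist (Φ ω) k - y) * ((n : ℝ) + 1)⌉₊, ω) :=
        (Nat.measurable_ceil.comp (by fun_prop)).prodMk measurable_id
      exact h1.comp h2
    refine tendsto_lintegral_of_dominated_convergence (fun _ => 1) hm
      (fun n => ae_of_all _ fun ω => hF1 _ _) ?_ ?_
    · rw [setLIntegral_one]; exact measure_ne_top P D
    · refine (ae_restrict_iff' hDm).2 (ae_of_all _ fun ω hω => ?_)
      exact hc ω _ _ (fun n => le_gridCeil y n _) (tendsto_gridCeil hω.2.le)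
  have hF1 : ∀ r, Measurable fun ω => expNeg (tailIntegral g (Φ ω) r) := fun r => by
    simp_rw [tailIntegral_eq_lintegral_indicator]
    exact measurable_expNeg.comp (h.measurable_lintegral
      (hg.indicator Metric.isClosed_closedBall.measurableSet.compl))
  have l1 := lim (fun ω r => expNeg (tailIntegral g (Φ ω) r)) hF1
    (fun _ _ => expNeg_le_one _) (fun ω r ρ => tendsto_expNeg_tailIntegral g (Φ ω))
  have l2 := lim (fun _ r => expNeg (tailIntegral (fun z => 1 - expNeg (g z))
    (ENNReal.ofReal lam • volume) r)) (fun r => measurable_const) (fun _ _ => expNeg_le_one _)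
    (fun ω r ρ => tendsto_expNeg_tailIntegral _ _)
  refine tendsto_nhds_unique l1 (l2.congr fun n => ?_)
  -- split according to the grid cell containing the `k`-th distance
  have hn : (0 : ℝ) < (n : ℝ) + 1 := by positivity
  let C : ℕ → Set Ω := fun j => {ω | x < nthDist (Φ ω) l ∧ y + j / ((n : ℝ) + 1) < nthDist (Φ ω) k ∧
    nthDist (Φ ω) k ≤ y + (j + 1) / ((n : ℝ) + 1)}
  have hCm : ∀ j, MeasurableSet (C j) := fun j =>
    (measurableSet_lt measurable_const hRl).inter
      ((measurableSet_lt measurable_const hRk).inter (measurableSet_le hRk measurable_const))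
  have hceil : ∀ j, ∀ ω ∈ C j, ⌈(nthDist (Φ ω) k - y) * ((n : ℝ) + 1)⌉₊ = j + 1 := by
    intro j ω hω
    rw [Nat.ceil_eq_iff (Nat.succ_ne_zero j)]
    have h1 := hω.2.1
    have h2 := hω.2.2
    constructor
    · rw [Nat.succ_sub_one, ← div_lt_iff₀ hn]; linarith
    · rw [← le_div_iff₀ hn]; push_cast; linarith
  have hgrid : ∀ j, ∀ ω ∈ C j, gridCeil y n (nthDist (Φ ω) k) = y + (j + 1) / ((n : ℝ) + 1) := by
    intro j ω hω
    rw [gridCeil, hceil j ω hω]; push_cast; rfl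
  have hU : D = ⋃ j, C j := by
    ext ω
    rw [mem_iUnion]
    constructor
    · rintro ⟨h1, h2⟩
      obtain ⟨j, hj⟩ : ∃ j, ⌈(nthDist (Φ ω) k - y) * ((n : ℝ) + 1)⌉₊ = j + 1 :=
        ⟨_, (Nat.succ_pred_eq_of_pos (Nat.ceil_pos.2 (mul_pos (sub_pos.2 h2) hn))).symm⟩
      rw [Nat.ceil_eq_iff (Nat.succ_ne_zero j), Nat.succ_sub_one, ← div_lt_iff₀ hn,
        ← le_div_iff₀ hn] at hj
      push_cast at hj
      exact ⟨j, h1, by linarith [hj.1], by linarith [hj.2]⟩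
    · rintro ⟨j, h1, h2, -⟩
      have : (0 : ℝ) ≤ j / ((n : ℝ) + 1) := by positivity
      exact ⟨h1, by linarith⟩
  have hCd : Pairwise (Function.onFun Disjoint C) := by
    intro i j hij
    refine disjoint_left.2 fun ω hi hj => hij ?_
    have := (hceil i ω hi).symm.trans (hceil j ω hj)
    omega
  rw [hU, lintegral_iUnion hCm hCd, lintegral_iUnion hCm hCd]
  refine tsum_congr fun j => ?_
  have hj : (0 : ℝ) ≤ j / ((n : ℝ) + 1) := by positivity
  have hj' : (j : ℝ) / ((n : ℝ) + 1) ≤ (j + 1) / ((n : ℝ) + 1) :=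
    div_le_div_of_nonneg_right (by linarith) hn.le
  have cell := h.setLIntegral_expNeg_tailIntegral_cell hlam hl hk hg (x := x)
    (b := y + j / ((n : ℝ) + 1)) (b' := y + (j + 1) / ((n : ℝ) + 1)) (by linarith) (by linarith)
  refine (setLIntegral_congr_fun (hCm j) fun ω hω => ?_).trans
    (cell.symm.trans (setLIntegral_congr_fun (hCm j) fun ω hω => ?_))
  · simp only [hgrid j ω hω]
  · simp only [hgrid j ω hω]

/-- Strong Markov property: given the `l`-th and the `k`-th distance, the points farther than the
`k`-th one have the Laplace functional of a Poisson process on the complement of a disc. -/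
lemma lintegral_mul_expNeg_tailIntegral
    (h : IsPoissonPointProcess P Φ (ENNReal.ofReal lam • volume)) (hlam : 0 < lam) {l k : ℕ}
    (hl : 1 ≤ l) (hlk : l < k) {g : Plane → ℝ≥0∞} (hg : Measurable g) {u : ℝ × ℝ → ℝ≥0∞}
    (hu : Measurable u) :
    ∫⁻ ω, u (nthDist (Φ ω) l, nthDist (Φ ω) k) *
        expNeg (tailIntegral g (Φ ω) (nthDist (Φ ω) k)) ∂P =
      ∫⁻ ω, u (nthDist (Φ ω) l, nthDist (Φ ω) k) *
        expNeg (tailIntegral (fun z => 1 - expNeg (g z)) (ENNReal.ofReal lam • volume)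
          (nthDist (Φ ω) k)) ∂P := by
  have hl0 : l ≠ 0 := by omega
  have hk0 : k ≠ 0 := by omega
  have hR : Measurable fun ω => (nthDist (Φ ω) l, nthDist (Φ ω) k) :=
    (h.measurable_nthDist l).prodMk (h.measurable_nthDist k)
  have hF1 := h.measurable_expNeg_tailIntegral hg k
  have hF2 := h.measurable_expNeg_tailIntegral_const (fun z => 1 - expNeg (g z))
    (ENNReal.ofReal lam • volume) k
  set F1 := fun ω => expNeg (tailIntegral g (Φ ω) (nthDist (Φ ω) k)) with hF1def
  set F2 := fun ω => expNeg (tailIntegral (fun z => 1 - expNeg (g z))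
    (ENNReal.ofReal lam • volume) (nthDist (Φ ω) k)) with hF2def
  have hfin : ∀ F : Ω → ℝ≥0∞, (∀ ω, F ω ≤ 1) → IsFiniteMeasure (P.withDensity F) := fun F hF =>
    isFiniteMeasure_withDensity ((lintegral_mono hF).trans_lt (by simp)).ne
  have := hfin F1 fun ω => expNeg_le_one _
  have hmS : MeasurableSet {r : ℝ × ℝ | 0 < r.1 ∧ r.1 ≤ r.2} :=
    (measurableSet_lt measurable_const measurable_fst).inter
      (measurableSet_le measurable_fst measurable_snd)
  have hae : ∀ F : Ω → ℝ≥0∞, ∀ᵐ r ∂((P.withDensity F).map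
      fun ω => (nthDist (Φ ω) l, nthDist (Φ ω) k)), 0 < r.1 ∧ r.1 ≤ r.2 := by
    intro F
    refine (ae_map_iff hR.aemeasurable hmS).2 ?_
    refine (withDensity_absolutelyContinuous P F).ae_le ?_
    filter_upwards [h.ae_nthDist_pos hlam hl0, h.ae_nthDist_le hlam hlk.le] with ω h1 h2
    exact ⟨h1, h2⟩
  have key : (P.withDensity F1).map (fun ω => (nthDist (Φ ω) l, nthDist (Φ ω) k)) =
      (P.withDensity F2).map (fun ω => (nthDist (Φ ω) l, nthDist (Φ ω) k)) := by
    refine ext_of_Ioi_prod_Ioi_of_le (hae F1) (hae F2) fun x y hx hxy => ?_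
    have hm := (measurableSet_Ioi (a := x)).prod (measurableSet_Ioi (a := y))
    rw [Measure.map_apply hR hm, Measure.map_apply hR hm, withDensity_apply _ (hR hm),
      withDensity_apply _ (hR hm)]
    exact h.setLIntegral_expNeg_tailIntegral_quadrant hlam hl0 hk0 hg hxy
  have huR : Measurable fun ω => u (nthDist (Φ ω) l, nthDist (Φ ω) k) := hu.comp hR
  have h1 := congrArg (fun m => ∫⁻ r, u r ∂m) key
  simp only [lintegral_map hu hR] at h1
  rw [lintegral_withDensity_eq_lintegral_mul _ hF1 huR,
    lintegral_withDensity_eq_lintegral_mul _ hF2 huR] at h1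
  simp only [Pi.mul_apply] at h1
  simp_rw [mul_comm (u _)]
  exact h1

end IsPoissonPointProcess

/-! ### Averaging over the marks of the interferers -/

/-- A mark: retention, serving distance and fading coefficient. -/
abbrev Mark : Type := Bool × ℝ × ℝ

/-- The counting measure of a sequence of points. -/
noncomputable def seqUsers (x : ℕ → Plane) : Measure Plane :=
  Measure.sum fun n => Measure.dirac (x n)

/-- The contribution `1{kept} G R^{αε} ‖z‖^{-α}` of an unscheduled user at `z` with mark `m` to the
interference. -/
noncomputable def contribution (α ε : ℝ) (z : Plane) (m : Mark) : ℝ≥0∞ :=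
  if m.1 = true then ENNReal.ofReal (m.2.2 * m.2.1 ^ (α * ε) * ‖z‖ ^ (-α)) else 0

/-- The interference caused by the points of `x`, with marks `m`, outside the disc of radius `r`. -/
noncomputable def seqInterference (α ε r : ℝ) (x : ℕ → Plane) (m : ℕ → Mark) : ℝ≥0∞ :=
  ∑' n, (Metric.closedBall 0 r)ᶜ.indicator (fun z => contribution α ε z (m n)) (x n)

/-- The mean of `exp (-s c)`, with `c` the contribution of a user at `z` whose mark has law `Q`. -/
noncomputable def meanExpContribution (α ε : ℝ) (Q : Measure Mark) (s : ℝ≥0∞) (z : Plane) : ℝ≥0∞ :=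
  ∫⁻ m, expNeg (s * contribution α ε z m) ∂Q

lemma measurable_contribution (α ε : ℝ) :
    Measurable fun q : Plane × Mark => contribution α ε q.1 q.2 := by
  refine Measurable.ite ?_ (by fun_prop) measurable_const
  exact (measurable_fst.comp measurable_snd) (measurableSet_singleton true)

lemma measurable_seqUsers : Measurable seqUsers := by
  refine Measure.measurable_of_measurable_coe _ fun s hs => ?_
  simp_rw [seqUsers, Measure.sum_apply _ hs, Measure.dirac_apply' _ hs]
  exact Measurable.tsum fun n =>
    (measurable_one.indicator hs).comp (measurable_pi_apply n)

lemma measurable_seqInterference (α ε : ℝ) (k : ℕ) :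
    Measurable fun q : (ℕ → Plane) × (ℕ → Mark) =>
      seqInterference α ε (nthDist (seqUsers q.1) k) q.1 q.2 := by
  refine Measurable.tsum fun n => ?_
  have hR : Measurable fun q : (ℕ → Plane) × (ℕ → Mark) => nthDist (seqUsers q.1) k :=
    (measurable_nthDist k).comp (measurable_seqUsers.comp measurable_fst)
  have hx : Measurable fun q : (ℕ → Plane) × (ℕ → Mark) => q.1 n :=
    (measurable_pi_apply n).comp measurable_fst
  have hm : Measurable fun q : (ℕ → Plane) × (ℕ → Mark) => q.2 n :=
    (measurable_pi_apply n).comp measurable_snd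
  have he : (fun q : (ℕ → Plane) × (ℕ → Mark) => (Metric.closedBall 0 (nthDist (seqUsers q.1) k))ᶜ.indicator
      (fun z => contribution α ε z (q.2 n)) (q.1 n)) = fun q =>
      if nthDist (seqUsers q.1) k < ‖q.1 n‖ then contribution α ε (q.1 n) (q.2 n) else 0 := by
    classical
    ext q
    simp [indicator_apply]
  rw [he]
  exact Measurable.ite (measurableSet_lt hR hx.norm)
    ((measurable_contribution α ε).comp (hx.prodMk hm)) measurable_const

lemma measurable_meanExpContribution (α ε : ℝ) (Q : Measure Mark) [SFinite Q] (s : ℝ≥0∞) :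
    Measurable (meanExpContribution α ε Q s) :=
  Measurable.lintegral_prod_right'
    (f := fun q : Plane × Mark => expNeg (s * contribution α ε q.1 q.2))
    (measurable_expNeg.comp ((measurable_contribution α ε).const_mul s))

lemma meanExpContribution_le_one (α ε : ℝ) (Q : Measure Mark) [IsProbabilityMeasure Q] (s : ℝ≥0∞)
    (z : Plane) : meanExpContribution α ε Q s z ≤ 1 :=
  (lintegral_mono fun _ => expNeg_le_one _).trans (by simp)

lemma tendsto_expNeg_sum_range (f : ℕ → ℝ≥0∞) :
    Tendsto (fun n => ∏ i ∈ Finset.range n, expNeg (f i)) atTop (𝓝 (expNeg (∑' i, f i))) := by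
  simp_rw [← expNeg_sum]
  exact (continuous_expNeg.tendsto _).comp (ENNReal.tendsto_nat_tsum f)

/-- Averaging over independent marks turns the interference of fixed points into a sum over the
points. -/
lemma lintegral_expNeg_seqInterference {Ω : Type*} [MeasurableSpace Ω] {P : Measure Ω}
    [IsProbabilityMeasure P] {Q : Measure Mark} [IsProbabilityMeasure Q] {Y : ℕ → Ω → Mark}
    (hY : ∀ n, Measurable (Y n)) (hlaw : ∀ n, P.map (Y n) = Q) (hind : iIndepFun Y P)
    (α ε r : ℝ) (s : ℝ≥0∞) (x : ℕ → Plane) :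
    ∫⁻ ω, expNeg (s * seqInterference α ε r x fun n => Y n ω) ∂P =
      expNeg (tailIntegral (fun z => negLog (meanExpContribution α ε Q s z)) (seqUsers x) r) := by
  have hcm : ∀ n, Measurable fun m : Mark =>
      expNeg (s * (Metric.closedBall 0 r)ᶜ.indicator (fun z => contribution α ε z m) (x n)) := by
    intro n
    by_cases hn : x n ∈ (Metric.closedBall (0 : Plane) r)ᶜ
    · simp only [indicator_of_mem hn]
      exact measurable_expNeg.comp
        (((measurable_contribution α ε).comp (measurable_const.prodMk measurable_id)).const_mul s)
    · simp only [indicator_of_notMem hn]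
      exact measurable_const
  have hfactor : ∀ n, ∫⁻ ω, expNeg (s * (Metric.closedBall 0 r)ᶜ.indicator
      (fun z => contribution α ε z (Y n ω)) (x n)) ∂P =
      expNeg ((Metric.closedBall 0 r)ᶜ.indicator
        (fun z => negLog (meanExpContribution α ε Q s z)) (x n)) := by
    intro n
    rw [← lintegral_map (hcm n) (hY n), hlaw n]
    by_cases hn : x n ∈ (Metric.closedBall (0 : Plane) r)ᶜ
    · simp only [indicator_of_mem hn]
      rw [expNeg_negLog (meanExpContribution_le_one α ε Q s _)]
      rfl
    · simp only [indicator_of_notMem hn]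
      simp
  have hm : ∀ n, Measurable fun ω => expNeg (s * (Metric.closedBall 0 r)ᶜ.indicator
      (fun z => contribution α ε z (Y n ω)) (x n)) := fun n => (hcm n).comp (hY n)
  have hindep : iIndepFun (fun n ω => expNeg (s * (Metric.closedBall 0 r)ᶜ.indicator
      (fun z => contribution α ε z (Y n ω)) (x n))) P := hind.comp _ hcm
  have h1 : Tendsto (fun N => ∫⁻ ω, ∏ n ∈ Finset.range N, expNeg (s *
      (Metric.closedBall 0 r)ᶜ.indicator (fun z => contribution α ε z (Y n ω)) (x n)) ∂P) atTop
      (𝓝 (∫⁻ ω, expNeg (s * seqInterference α ε r x fun n => Y n ω) ∂P)) := by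
    refine tendsto_lintegral_of_dominated_convergence (fun _ => 1)
      (fun N => Finset.measurable_prod _ fun n _ => hm n)
      (fun N => ae_of_all _ fun ω => Finset.prod_le_one' fun n _ => expNeg_le_one _) (by simp)
      (ae_of_all _ fun ω => ?_)
    rw [seqInterference, ← ENNReal.tsum_mul_left]
    exact tendsto_expNeg_sum_range _
  refine tendsto_nhds_unique h1 ?_
  simp_rw [lintegral_prod_eq_prod_lintegral_of_indepFun _ _ hindep hm, hfactor]
  rw [tailIntegral_eq_lintegral_indicator, seqUsers, lintegral_sum_measure]
  simp_rw [lintegral_dirac]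
  exact tendsto_expNeg_sum_range _

namespace UplinkModel

variable {Ω : Type*} [MeasurableSpace Ω] {P : Measure Ω} {lam p mu : ℝ}
  (M : UplinkModel P lam p mu)

/-- The sequence of the user locations. -/
def points (ω : Ω) (n : ℕ) : Plane := M.point n ω

/-- The sequence of the marks. -/
def marks (ω : Ω) (n : ℕ) : Mark := (M.kept n ω, M.servDist n ω, M.fading n ω)

lemma measurable_points : Measurable M.points := measurable_pi_lambda _ M.measurable_point

lemma measurable_marks : Measurable M.marks := measurable_pi_lambda _ fun n =>
  (M.measurable_kept n).prodMk ((M.measurable_servDist n).prodMk (M.measurable_fading n))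

lemma isPoissonPointProcess_users :
    IsPoissonPointProcess P M.users (ENNReal.ofReal lam • volume) := M.poisson

lemma dist_eq_nthDist (j : ℕ) (ω : Ω) : M.dist j ω = nthDist (M.users ω) j := rfl

lemma measurable_dist (j : ℕ) : Measurable (M.dist j) :=
  M.isPoissonPointProcess_users.measurable_nthDist j

open Classical in
lemma interference_eq (α ε : ℝ) (k : ℕ) (ω : Ω) : M.interference α ε k ω =
    seqInterference α ε (nthDist (seqUsers (M.points ω)) k) (M.points ω) (M.marks ω) := by
  refine tsum_congr fun n => ?_
  by_cases h1 : M.point n ω ∈ (Metric.closedBall 0 (M.dist k ω))ᶜ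
  · have h1' : M.points ω n ∈ (Metric.closedBall 0 (nthDist (seqUsers (M.points ω)) k))ᶜ := h1
    rw [indicator_of_mem h1', contribution]
    refine if_congr ?_ rfl rfl
    exact and_iff_right h1
  · have h1' : M.points ω n ∉ (Metric.closedBall 0 (nthDist (seqUsers (M.points ω)) k))ᶜ := h1
    rw [indicator_of_notMem h1', if_neg fun h => h1 h.1]

lemma measurable_interference (α ε : ℝ) (k : ℕ) : Measurable (M.interference α ε k) := by
  have h : M.interference α ε k = (fun q : (ℕ → Plane) × (ℕ → Mark) =>
      seqInterference α ε (nthDist (seqUsers q.1) k) q.1 q.2) ∘ fun ω => (M.points ω, M.marks ω) :=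
    funext (M.interference_eq α ε k)
  rw [h]
  exact (measurable_seqInterference α ε k).comp (M.measurable_points.prodMk M.measurable_marks)

/-- The law of a mark. -/
noncomputable def markLaw (lam p mu : ℝ) : Measure Mark :=
  (thinningMeasure p).prod ((rayleighMeasure (p * lam)).prod (expMeasure mu))

lemma isProbabilityMeasure_markLaw [IsProbabilityMeasure P] (M : UplinkModel P lam p mu) :
    IsProbabilityMeasure (markLaw lam p mu) := by
  rw [markLaw, ← M.mark_law 0]
  exact Measure.isProbabilityMeasure_map ((M.measurable_kept 0).prodMk
    ((M.measurable_servDist 0).prodMk (M.measurable_fading 0))).aemeasurable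

lemma indepFun_points_marks : IndepFun M.points M.marks P :=
  M.point_indep.comp (φ := id) (ψ := Prod.snd) measurable_id measurable_snd

/-- The Laplace transform of the interference given the locations of the users. -/
lemma lintegral_mul_expNeg_interference [IsProbabilityMeasure P] (α ε : ℝ) (l k : ℕ) (s : ℝ≥0∞)
    {u : ℝ × ℝ → ℝ≥0∞} (hu : Measurable u) :
    ∫⁻ ω, u (M.dist l ω, M.dist k ω) * expNeg (s * M.interference α ε k ω) ∂P =
      ∫⁻ ω, u (M.dist l ω, M.dist k ω) * expNeg (tailIntegral
        (fun z => negLog (meanExpContribution α ε (markLaw lam p mu) s z)) (M.users ω)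
        (M.dist k ω)) ∂P := by
  have := M.isProbabilityMeasure_markLaw
  have hR : ∀ j, Measurable fun x : ℕ → Plane => nthDist (seqUsers x) j := fun j =>
    (measurable_nthDist j).comp measurable_seqUsers
  have hU : Measurable fun x : ℕ → Plane => u (nthDist (seqUsers x) l, nthDist (seqUsers x) k) :=
    hu.comp ((hR l).prodMk (hR k))
  have hF : Measurable fun q : (ℕ → Plane) × (ℕ → Mark) =>
      u (nthDist (seqUsers q.1) l, nthDist (seqUsers q.1) k) *
        expNeg (s * seqInterference α ε (nthDist (seqUsers q.1) k) q.1 q.2) :=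
    (hU.comp measurable_fst).mul
      (measurable_expNeg.comp ((measurable_seqInterference α ε k).const_mul s))
  have hmap := (indepFun_iff_map_prod_eq_prod_map_map M.measurable_points.aemeasurable
    M.measurable_marks.aemeasurable).1 M.indepFun_points_marks
  have : IsProbabilityMeasure (P.map M.marks) :=
    Measure.isProbabilityMeasure_map M.measurable_marks.aemeasurable
  have h1 : ∫⁻ ω, u (M.dist l ω, M.dist k ω) * expNeg (s * M.interference α ε k ω) ∂P =
      ∫⁻ q, u (nthDist (seqUsers q.1) l, nthDist (seqUsers q.1) k) *
        expNeg (s * seqInterference α ε (nthDist (seqUsers q.1) k) q.1 q.2)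
        ∂(P.map fun ω => (M.points ω, M.marks ω)) := by
    rw [lintegral_map hF (M.measurable_points.prodMk M.measurable_marks)]
    simp_rw [M.interference_eq]
    rfl
  rw [h1, hmap, lintegral_prod _ hF.aemeasurable,
    lintegral_map hF.lintegral_prod_right' M.measurable_points]
  refine lintegral_congr fun ω => ?_
  have hm : Measurable fun m : ℕ → Mark => expNeg (s * seqInterference α ε
      (nthDist (seqUsers (M.points ω)) k) (M.points ω) m) :=
    measurable_expNeg.comp (((measurable_seqInterference α ε k).comp
      (measurable_const.prodMk measurable_id)).const_mul s)
  change ∫⁻ m, u (nthDist (seqUsers (M.points ω)) l, nthDist (seqUsers (M.points ω)) k) *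
    expNeg (s * seqInterference α ε (nthDist (seqUsers (M.points ω)) k) (M.points ω) m)
      ∂(P.map M.marks) = _
  rw [lintegral_const_mul _ hm, lintegral_map hm M.measurable_marks]
  congr 1
  exact lintegral_expNeg_seqInterference (Q := markLaw lam p mu) (fun n => (measurable_pi_apply n).comp M.measurable_marks)
    M.mark_law M.mark_indep α ε _ s (M.points ω)

/-- The Laplace transform of the interference given the two distances. -/
lemma lintegral_mul_expNeg_interference_eq [IsProbabilityMeasure P] (hlam : 0 < lam) (α ε : ℝ)
    {l k : ℕ} (hl : 1 ≤ l) (hlk : l < k) (s : ℝ≥0∞) {u : ℝ × ℝ → ℝ≥0∞} (hu : Measurable u) :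
    ∫⁻ ω, u (M.dist l ω, M.dist k ω) * expNeg (s * M.interference α ε k ω) ∂P =
      ∫⁻ ω, u (M.dist l ω, M.dist k ω) * expNeg (tailIntegral
        (fun z => 1 - meanExpContribution α ε (markLaw lam p mu) s z)
        (ENNReal.ofReal lam • volume) (M.dist k ω)) ∂P := by
  have := M.isProbabilityMeasure_markLaw
  rw [M.lintegral_mul_expNeg_interference α ε l k s hu]
  have h := M.isPoissonPointProcess_users.lintegral_mul_expNeg_tailIntegral hlam hl hlk
    (g := fun z => negLog (meanExpContribution α ε (markLaw lam p mu) s z))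
    (measurable_negLog.comp (measurable_meanExpContribution α ε _ s)) hu
  simp_rw [expNeg_negLog (meanExpContribution_le_one α ε (markLaw lam p mu) s _)] at h
  exact h

end UplinkModel

/-! ### The mean effect of a single interferer -/

instance sFinite_thinningMeasure (p : ℝ) : SFinite (thinningMeasure p) := by
  unfold thinningMeasure; infer_instance

instance sFinite_rayleighMeasure (c : ℝ) : SFinite (rayleighMeasure c) := by
  unfold rayleighMeasure; infer_instance

instance sFinite_expMeasure (r : ℝ) : SFinite (expMeasure r) := by
  unfold expMeasure gammaMeasure; infer_instance

lemma lintegral_thinningMeasure (p : ℝ) (f : Bool → ℝ≥0∞) :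
    ∫⁻ b, f b ∂(thinningMeasure p) =
      ENNReal.ofReal p * f true + ENNReal.ofReal (1 - p) * f false := by
  simp [thinningMeasure]

lemma lintegral_expMeasure (r : ℝ) {f : ℝ → ℝ≥0∞} (hf : Measurable f) :
    ∫⁻ x, f x ∂(expMeasure r) = ∫⁻ x, exponentialPDF r x * f x := by
  have hm : Measurable (exponentialPDF r) := (measurable_exponentialPDFReal r).ennreal_ofReal
  have h : expMeasure r = volume.withDensity (exponentialPDF r) := rfl
  rw [h, lintegral_withDensity_eq_lintegral_mul _ hm hf]
  rfl

lemma lintegral_expNeg_expMeasure {mu σ a : ℝ} (hmu : 0 < mu) (hσ : 0 ≤ σ) (ha : 0 ≤ a) :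
    ∫⁻ x, expNeg (ENNReal.ofReal σ * ENNReal.ofReal (x * a)) ∂(expMeasure mu) =
      ENNReal.ofReal (1 / (1 + σ / mu * a)) := by
  have hr : 0 < mu + σ * a := by positivity
  have hm : Measurable (exponentialPDF (mu + σ * a)) :=
    (measurable_exponentialPDFReal _).ennreal_ofReal
  rw [lintegral_expMeasure mu (by fun_prop)]
  have h : ∀ x, exponentialPDF mu x * expNeg (ENNReal.ofReal σ * ENNReal.ofReal (x * a)) =
      ENNReal.ofReal (1 / (1 + σ / mu * a)) * exponentialPDF (mu + σ * a) x := by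
    intro x
    rcases lt_or_ge x 0 with hx | hx
    · simp [exponentialPDF_of_neg hx]
    · rw [exponentialPDF_of_nonneg hx, exponentialPDF_of_nonneg hx, ← ENNReal.ofReal_mul hσ,
        expNeg_ofReal (by positivity), ← ENNReal.ofReal_mul (by positivity),
        ← ENNReal.ofReal_mul (by positivity)]
      congr 1
      rw [mul_assoc, ← Real.exp_add, show -(mu * x) + -(σ * (x * a)) = -((mu + σ * a) * x) by ring]
      field_simp
  simp_rw [h]
  rw [lintegral_const_mul _ hm, lintegral_exponentialPDF_eq_one hr, mul_one]

/-- The square of a Rayleigh variable is exponential. -/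
lemma lintegral_rayleighMeasure (c : ℝ) {f : ℝ → ℝ≥0∞} (hf : Measurable f) :
    ∫⁻ x, f x ∂(rayleighMeasure c) =
      ∫⁻ q in Ioi 0, ENNReal.ofReal (Real.pi * c * Real.exp (-(c * Real.pi * q))) * f (√q) := by
  have himage : (fun x : ℝ => x ^ 2) '' Ioi 0 = Ioi 0 := by
    ext q
    constructor
    · rintro ⟨x, hx, rfl⟩
      exact mem_Ioi.2 (pow_pos (mem_Ioi.1 hx) 2)
    · intro hq
      exact ⟨√q, Real.sqrt_pos.2 hq, Real.sq_sqrt (le_of_lt hq)⟩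
  have h1 := lintegral_image_eq_lintegral_abs_deriv_mul (measurableSet_Ioi (a := (0 : ℝ)))
    (fun x _ => (hasDerivAt_pow 2 x).hasDerivWithinAt)
    (fun x hx y hy hxy => (pow_left_inj₀ (le_of_lt hx) (le_of_lt hy) two_ne_zero).1 hxy)
    (fun q => ENNReal.ofReal (Real.pi * c * Real.exp (-(c * Real.pi * q))) * f (√q))
  rw [himage] at h1
  have hm : Measurable fun r : ℝ => ENNReal.ofReal
      (if 0 ≤ r then 2 * Real.pi * c * r * Real.exp (-(c * Real.pi * r ^ 2)) else 0) :=
    (Measurable.ite measurableSet_Ici (by fun_prop) measurable_const).ennreal_ofReal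
  rw [h1, rayleighMeasure, lintegral_withDensity_eq_lintegral_mul _ hm hf,
    ← lintegral_indicator measurableSet_Ioi]
  have hne : ∀ᵐ x : ℝ, x ≠ 0 := by simp [ae_iff]
  refine lintegral_congr_ae ?_
  filter_upwards [hne] with x hx
  rcases lt_or_gt_of_ne hx with hx | hx
  · rw [indicator_of_notMem (notMem_Ioi.2 hx.le)]
    simp [hx.not_ge]
  · rw [indicator_of_mem (mem_Ioi.2 hx), Real.sqrt_sq hx.le, Pi.mul_apply, if_pos hx.le, ← mul_assoc,
      ← ENNReal.ofReal_mul (abs_nonneg _), abs_of_nonneg (by simpa using hx.le)]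
    congr 2
    simp; ring

/-- `E[1 / (1 + c R^{αε} v^{-α})]` for a Rayleigh serving distance `R`, written with `q = R²`. -/
noncomputable def interfererLaplace (lam p α ε c v : ℝ) : ℝ :=
  ∫ q in Ioi (0 : ℝ), Real.pi * p * lam * Real.exp (-(p * lam * Real.pi * q)) /
    (1 + c * q ^ (α * ε / 2) * v ^ (-α))

section interferer

variable {lam p α ε : ℝ}

lemma integrableOn_rpow_mul_exp (hlam : 0 < lam) (hp : 0 < p) {β : ℝ} (hβ : 0 ≤ β) :
    IntegrableOn (fun q : ℝ => Real.pi * p * lam * Real.exp (-(p * lam * Real.pi * q)) * q ^ β)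
      (Ioi 0) := by
  have hb : 0 < p * lam * Real.pi := by positivity
  have h := (integrableOn_rpow_mul_exp_neg_mul_rpow (p := 1) (s := β) (by linarith) one_pos
    hb).const_mul (Real.pi * p * lam)
  refine IntegrableOn.congr_fun h (fun q _ => ?_) measurableSet_Ioi
  simp only [Real.rpow_one, neg_mul]
  ring

lemma integrableOn_exp_density (hlam : 0 < lam) (hp : 0 < p) :
    IntegrableOn (fun q : ℝ => Real.pi * p * lam * Real.exp (-(p * lam * Real.pi * q)))
      (Ioi 0) := by
  simpa using integrableOn_rpow_mul_exp hlam hp (β := 0) le_rfl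

lemma integral_exp_density (hlam : 0 < lam) (hp : 0 < p) :
    ∫ q in Ioi (0 : ℝ), Real.pi * p * lam * Real.exp (-(p * lam * Real.pi * q)) = 1 := by
  have hb : 0 < p * lam * Real.pi := by positivity
  rw [integral_const_mul]
  have h := integral_exp_mul_Ioi (neg_lt_zero.2 hb) 0
  simp only [neg_mul, mul_zero, Real.exp_zero] at h
  rw [h]
  field_simp

lemma measurable_interfererLaplace_integrand (c : ℝ) :
    Measurable fun x : ℝ × ℝ => Real.pi * p * lam * Real.exp (-(p * lam * Real.pi * x.2)) /
      (1 + c * x.2 ^ (α * ε / 2) * x.1 ^ (-α)) := by fun_prop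

lemma measurable_interfererLaplace (lam p α ε c : ℝ) :
    Measurable (interfererLaplace lam p α ε c) :=
  (measurable_interfererLaplace_integrand c).stronglyMeasurable.integral_prod_right.measurable

lemma interfererLaplace_integrand_nonneg (hlam : 0 < lam) (hp : 0 < p) {c v q : ℝ} (hc : 0 ≤ c)
    (hv : 0 ≤ v) (hq : 0 ≤ q) : 0 ≤ Real.pi * p * lam * Real.exp (-(p * lam * Real.pi * q)) /
      (1 + c * q ^ (α * ε / 2) * v ^ (-α)) := by positivity

lemma interfererLaplace_integrand_le (hlam : 0 < lam) (hp : 0 < p) {c v q : ℝ} (hc : 0 ≤ c)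
    (hv : 0 ≤ v) (hq : 0 ≤ q) : Real.pi * p * lam * Real.exp (-(p * lam * Real.pi * q)) /
      (1 + c * q ^ (α * ε / 2) * v ^ (-α)) ≤
      Real.pi * p * lam * Real.exp (-(p * lam * Real.pi * q)) := by
  refine div_le_self (by positivity) ?_
  have : 0 ≤ c * q ^ (α * ε / 2) * v ^ (-α) := by positivity
  linarith

lemma integrableOn_interfererLaplace (hlam : 0 < lam) (hp : 0 < p) {c v : ℝ} (hc : 0 ≤ c)
    (hv : 0 ≤ v) : IntegrableOn (fun q => Real.pi * p * lam *
      Real.exp (-(p * lam * Real.pi * q)) / (1 + c * q ^ (α * ε / 2) * v ^ (-α))) (Ioi 0) := by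
  refine Integrable.mono' (integrableOn_exp_density hlam hp)
    ((measurable_interfererLaplace_integrand c).comp
      (measurable_const.prodMk measurable_id)).aestronglyMeasurable ?_
  refine (ae_restrict_iff' measurableSet_Ioi).2 (ae_of_all _ fun q hq => ?_)
  change ‖Real.pi * p * lam * Real.exp (-(p * lam * Real.pi * q)) /
      (1 + c * q ^ (α * ε / 2) * v ^ (-α))‖ ≤ _
  rw [Real.norm_of_nonneg (interfererLaplace_integrand_nonneg hlam hp hc hv (le_of_lt hq))]
  exact interfererLaplace_integrand_le hlam hp hc hv (le_of_lt hq)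

lemma interfererLaplace_nonneg (hlam : 0 < lam) (hp : 0 < p) {c v : ℝ} (hc : 0 ≤ c) (hv : 0 ≤ v) :
    0 ≤ interfererLaplace lam p α ε c v :=
  setIntegral_nonneg measurableSet_Ioi fun _ hq =>
    interfererLaplace_integrand_nonneg hlam hp hc hv (le_of_lt hq)

lemma interfererLaplace_le_one (hlam : 0 < lam) (hp : 0 < p) {c v : ℝ} (hc : 0 ≤ c) (hv : 0 ≤ v) :
    interfererLaplace lam p α ε c v ≤ 1 := by
  rw [← integral_exp_density hlam hp]
  exact setIntegral_mono_on (integrableOn_interfererLaplace hlam hp hc hv)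
    (integrableOn_exp_density hlam hp) measurableSet_Ioi fun _ hq =>
    interfererLaplace_integrand_le hlam hp hc hv (le_of_lt hq)

lemma interfererLaplace_zero (hlam : 0 < lam) (hp : 0 < p) (v : ℝ) :
    interfererLaplace lam p α ε 0 v = 1 := by
  simp [interfererLaplace, integral_exp_density hlam hp]

/-- `1 - 1 / (1 + y) ≤ y` bounds the effect of an interferer by the mean path loss. -/
lemma one_sub_interfererLaplace_le (hlam : 0 < lam) (hp : 0 < p) (hβ : 0 ≤ α * ε / 2) {c v : ℝ}
    (hc : 0 ≤ c) (hv : 0 ≤ v) : 1 - interfererLaplace lam p α ε c v ≤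
      c * v ^ (-α) * ∫ q in Ioi (0 : ℝ),
        Real.pi * p * lam * Real.exp (-(p * lam * Real.pi * q)) * q ^ (α * ε / 2) := by
  rw [← integral_exp_density hlam hp, interfererLaplace,
    ← integral_sub (integrableOn_exp_density hlam hp) (integrableOn_interfererLaplace hlam hp hc hv),
    ← integral_const_mul]
  refine setIntegral_mono_on ((integrableOn_exp_density hlam hp).sub
    (integrableOn_interfererLaplace hlam hp hc hv))
    ((integrableOn_rpow_mul_exp hlam hp hβ).const_mul _) measurableSet_Ioi fun q hq => ?_
  have hq0 : 0 ≤ q := le_of_lt hq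
  set f := Real.pi * p * lam * Real.exp (-(p * lam * Real.pi * q)) with hf
  have hf0 : 0 ≤ f := by positivity
  set y := c * q ^ (α * ε / 2) * v ^ (-α) with hy
  have hy0 : 0 ≤ y := by positivity
  have h1 : c * v ^ (-α) * (f * q ^ (α * ε / 2)) = f * y := by rw [hy]; ring
  rw [h1, sub_le_iff_le_add, ← sub_le_iff_le_add', le_div_iff₀ (by positivity)]
  nlinarith [mul_nonneg hf0 (mul_nonneg hy0 hy0)]

lemma tendsto_interfererLaplace (hlam : 0 < lam) (hp : 0 < p) {c : ℕ → ℝ} {c' v : ℝ}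
    (hc : ∀ n, 0 ≤ c n) (hlim : Tendsto c atTop (𝓝 c')) (hv : 0 ≤ v) :
    Tendsto (fun n => interfererLaplace lam p α ε (c n) v) atTop
      (𝓝 (interfererLaplace lam p α ε c' v)) := by
  have hc' : 0 ≤ c' := ge_of_tendsto' hlim hc
  refine tendsto_integral_of_dominated_convergence _
    (fun n => (integrableOn_interfererLaplace hlam hp (hc n) hv).aestronglyMeasurable)
    (integrableOn_exp_density hlam hp) (fun n => ?_) ?_
  · refine (ae_restrict_iff' measurableSet_Ioi).2 (ae_of_all _ fun q hq => ?_)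
    rw [Real.norm_of_nonneg (interfererLaplace_integrand_nonneg hlam hp (hc n) hv (le_of_lt hq))]
    exact interfererLaplace_integrand_le hlam hp (hc n) hv (le_of_lt hq)
  · refine (ae_restrict_iff' measurableSet_Ioi).2 (ae_of_all _ fun q hq => ?_)
    have hq0 : 0 ≤ q := le_of_lt hq
    refine tendsto_const_nhds.div ((((hlim.mul_const _).mul_const _)).const_add 1) ?_
    positivity

lemma meanExpContribution_eq (hlam : 0 < lam) (hp : 0 < p) (hp1 : p ≤ 1) {mu : ℝ} (hmu : 0 < mu)
    {σ : ℝ} (hσ : 0 ≤ σ) (z : Plane) :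
    1 - meanExpContribution α ε (UplinkModel.markLaw lam p mu) (ENNReal.ofReal σ) z =
      ENNReal.ofReal (p * (1 - interfererLaplace lam p α ε (σ / mu) ‖z‖)) := by
  have hc : 0 ≤ σ / mu := by positivity
  have hv : 0 ≤ ‖z‖ := norm_nonneg z
  have hmeas : Measurable fun m : Mark => expNeg (ENNReal.ofReal σ * contribution α ε z m) :=
    measurable_expNeg.comp
      (((measurable_contribution α ε).comp (measurable_const.prodMk measurable_id)).const_mul _)
  have hmeas2 : Measurable fun x : ℝ × ℝ => expNeg (ENNReal.ofReal σ *
      ENNReal.ofReal (x.2 * (x.1 ^ (α * ε) * ‖z‖ ^ (-α)))) := by fun_prop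
  have hJ : ∫⁻ x : ℝ × ℝ, expNeg (ENNReal.ofReal σ *
      ENNReal.ofReal (x.2 * (x.1 ^ (α * ε) * ‖z‖ ^ (-α))))
        ∂((rayleighMeasure (p * lam)).prod (expMeasure mu)) =
      ENNReal.ofReal (interfererLaplace lam p α ε (σ / mu) ‖z‖) := by
    rw [lintegral_prod _ hmeas2.aemeasurable, lintegral_rayleighMeasure _ hmeas2.lintegral_prod_right',
      interfererLaplace, ofReal_integral_eq_lintegral_ofReal
        (integrableOn_interfererLaplace hlam hp hc hv)
        ((ae_restrict_iff' measurableSet_Ioi).2 (ae_of_all _ fun q hq =>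
          interfererLaplace_integrand_nonneg hlam hp hc hv (le_of_lt hq)))]
    refine setLIntegral_congr_fun measurableSet_Ioi fun q hq => ?_
    have hq0 : 0 ≤ q := le_of_lt hq
    have hsq : √q ^ (α * ε) = q ^ (α * ε / 2) := by
      rw [Real.sqrt_eq_rpow, ← Real.rpow_mul hq0]; congr 1; ring
    simp only [hsq]
    rw [lintegral_expNeg_expMeasure hmu hσ (by positivity), ← ENNReal.ofReal_mul (by positivity)]
    congr 1
    rw [← mul_assoc (σ / mu), ← mul_assoc Real.pi]
    ring
  have h0 := interfererLaplace_nonneg (α := α) (ε := ε) hlam hp hc hv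
  have h1 := interfererLaplace_le_one (α := α) (ε := ε) hlam hp hc hv
  have hw : meanExpContribution α ε (UplinkModel.markLaw lam p mu) (ENNReal.ofReal σ) z =
      ENNReal.ofReal (p * interfererLaplace lam p α ε (σ / mu) ‖z‖ + (1 - p)) := by
    have : IsProbabilityMeasure (expMeasure mu) := isProbabilityMeasure_expMeasure hmu
    have hray : (rayleighMeasure (p * lam)) univ = 1 := by
      rw [← setLIntegral_one, Measure.restrict_univ, lintegral_rayleighMeasure _ measurable_const]
      simp_rw [mul_one, ← mul_assoc Real.pi]
      rw [← ofReal_integral_eq_lintegral_ofReal (integrableOn_exp_density hlam hp)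
        (ae_of_all _ fun q => by positivity), integral_exp_density hlam hp, ENNReal.ofReal_one]
    rw [meanExpContribution, UplinkModel.markLaw, lintegral_prod _ hmeas.aemeasurable,
      lintegral_thinningMeasure]
    simp only [contribution, if_true, mul_assoc, Bool.false_eq_true, if_false, mul_zero,
      expNeg_zero, lintegral_one]
    rw [hJ, ← univ_prod_univ, Measure.prod_prod, hray, measure_univ, mul_one, mul_one,
      ← ENNReal.ofReal_mul hp.le, ← ENNReal.ofReal_add (by positivity) (by linarith)]
  rw [hw, ← ENNReal.ofReal_one, ← ENNReal.ofReal_sub]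
  · congr 1; ring
  · have := mul_nonneg hp.le h0
    linarith

/-! ### The exponent of the conditional Laplace transform -/

/-- The exponent of the Laplace transform of the interference from outside the disc of
radius `r`. -/
noncomputable def laplaceExponent (lam p α ε c r : ℝ) : ℝ :=
  2 * Real.pi * p * lam * ∫ v in Ioi r, (1 - interfererLaplace lam p α ε c v) * v

lemma integrableOn_laplaceExponent_bound (hα : 2 < α) {r : ℝ} (hr : 0 < r) (C : ℝ) :
    IntegrableOn (fun v : ℝ => C * v ^ (1 - α)) (Ioi r) :=
  (integrableOn_Ioi_rpow_of_lt (by linarith) hr).const_mul C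

lemma laplaceExponent_integrand_nonneg (hlam : 0 < lam) (hp : 0 < p) {c v : ℝ} (hc : 0 ≤ c)
    (hv : 0 ≤ v) : 0 ≤ (1 - interfererLaplace lam p α ε c v) * v :=
  mul_nonneg (sub_nonneg.2 (interfererLaplace_le_one hlam hp hc hv)) hv

lemma laplaceExponent_integrand_le (hlam : 0 < lam) (hp : 0 < p) (hβ : 0 ≤ α * ε / 2) {c C v : ℝ}
    (hc : 0 ≤ c) (hcC : c ≤ C) (hv : 0 < v) : (1 - interfererLaplace lam p α ε c v) * v ≤
      (C * ∫ q in Ioi (0 : ℝ), Real.pi * p * lam * Real.exp (-(p * lam * Real.pi * q)) *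
        q ^ (α * ε / 2)) * v ^ (1 - α) := by
  have hK : 0 ≤ ∫ q in Ioi (0 : ℝ), Real.pi * p * lam * Real.exp (-(p * lam * Real.pi * q)) *
      q ^ (α * ε / 2) := setIntegral_nonneg measurableSet_Ioi fun q hq => by
    have : (0 : ℝ) ≤ q := le_of_lt hq
    positivity
  set K := ∫ q in Ioi (0 : ℝ), Real.pi * p * lam * Real.exp (-(p * lam * Real.pi * q)) *
      q ^ (α * ε / 2)
  have h1 : v ^ (1 - α) = v ^ (-α) * v := by
    rw [sub_eq_neg_add, Real.rpow_add hv, Real.rpow_one]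
  calc (1 - interfererLaplace lam p α ε c v) * v ≤ (c * v ^ (-α) * K) * v :=
        mul_le_mul_of_nonneg_right (one_sub_interfererLaplace_le hlam hp hβ hc hv.le) hv.le
    _ = c * (v ^ (-α) * K * v) := by ring
    _ ≤ C * (v ^ (-α) * K * v) := mul_le_mul_of_nonneg_right hcC (by positivity)
    _ = (C * K) * v ^ (1 - α) := by rw [h1]; ring

lemma integrableOn_laplaceExponent (hlam : 0 < lam) (hp : 0 < p) (hα : 2 < α)
    (hβ : 0 ≤ α * ε / 2) {c r : ℝ} (hc : 0 ≤ c) (hr : 0 < r) :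
    IntegrableOn (fun v => (1 - interfererLaplace lam p α ε c v) * v) (Ioi r) := by
  refine Integrable.mono' (integrableOn_laplaceExponent_bound hα hr
    (c * ∫ q in Ioi (0 : ℝ), Real.pi * p * lam * Real.exp (-(p * lam * Real.pi * q)) *
        q ^ (α * ε / 2)))
    (((measurable_interfererLaplace lam p α ε c).const_sub 1).mul
      measurable_id).aestronglyMeasurable ?_
  refine (ae_restrict_iff' measurableSet_Ioi).2 (ae_of_all _ fun v hv => ?_)
  have hv0 : 0 < v := hr.trans hv
  rw [Real.norm_of_nonneg (laplaceExponent_integrand_nonneg hlam hp hc hv0.le)]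
  exact laplaceExponent_integrand_le hlam hp hβ hc le_rfl hv0

lemma tendsto_laplaceExponent (hlam : 0 < lam) (hp : 0 < p) (hα : 2 < α) (hβ : 0 ≤ α * ε / 2)
    {c : ℕ → ℝ} {c' r : ℝ} (hc : ∀ n, 0 ≤ c n) (hlim : Tendsto c atTop (𝓝 c')) (hr : 0 < r) :
    Tendsto (fun n => laplaceExponent lam p α ε (c n) r) atTop
      (𝓝 (laplaceExponent lam p α ε c' r)) := by
  obtain ⟨C, hC⟩ := hlim.bddAbove_range
  refine Tendsto.const_mul _ (tendsto_integral_of_dominated_convergence _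
    (fun n => (integrableOn_laplaceExponent hlam hp hα hβ (hc n) hr).aestronglyMeasurable)
    (integrableOn_laplaceExponent_bound hα hr
    (C * ∫ q in Ioi (0 : ℝ), Real.pi * p * lam * Real.exp (-(p * lam * Real.pi * q)) *
        q ^ (α * ε / 2))) (fun n => ?_) ?_)
  · refine (ae_restrict_iff' measurableSet_Ioi).2 (ae_of_all _ fun v hv => ?_)
    have hv0 : 0 < v := hr.trans hv
    rw [Real.norm_of_nonneg (laplaceExponent_integrand_nonneg hlam hp (hc n) hv0.le)]
    exact laplaceExponent_integrand_le hlam hp hβ (hc n) (hC (mem_range_self n)) hv0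
  · refine (ae_restrict_iff' measurableSet_Ioi).2 (ae_of_all _ fun v hv => ?_)
    have hv0 : 0 < v := hr.trans hv
    exact ((tendsto_interfererLaplace hlam hp hc hlim hv0.le).const_sub 1).mul_const v

lemma laplaceExponent_nonneg (hlam : 0 < lam) (hp : 0 < p) {c r : ℝ} (hc : 0 ≤ c) (hr : 0 < r) :
    0 ≤ laplaceExponent lam p α ε c r :=
  mul_nonneg (by positivity) (setIntegral_nonneg measurableSet_Ioi fun _ hv =>
    laplaceExponent_integrand_nonneg hlam hp hc (hr.trans hv).le)

lemma laplaceExponent_zero (hlam : 0 < lam) (hp : 0 < p) (r : ℝ) :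
    laplaceExponent lam p α ε 0 r = 0 := by
  simp [laplaceExponent, interfererLaplace_zero hlam hp]

/-- The exponent in polar coordinates. -/
lemma tailIntegral_meanExpContribution (hlam : 0 < lam) (hp : 0 < p) (hp1 : p ≤ 1) {mu : ℝ}
    (hmu : 0 < mu) (hα : 2 < α) (hβ : 0 ≤ α * ε / 2) {σ r : ℝ} (hσ : 0 ≤ σ) (hr : 0 < r) :
    tailIntegral (fun z => 1 - meanExpContribution α ε (UplinkModel.markLaw lam p mu)
      (ENNReal.ofReal σ) z) (ENNReal.ofReal lam • volume) r =
      ENNReal.ofReal (laplaceExponent lam p α ε (σ / mu) r) := by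
  have hc : 0 ≤ σ / mu := by positivity
  set h : ℝ → ℝ := (Ioi r).indicator fun v => p * (1 - interfererLaplace lam p α ε (σ / mu) v)
    with hdef
  have hh0 : ∀ v, 0 ≤ h v := fun v => by
    refine indicator_nonneg (fun v hv => ?_) v
    have := interfererLaplace_le_one (α := α) (ε := ε) hlam hp hc (hr.trans hv).le
    exact mul_nonneg hp.le (by linarith)
  have hdim : Module.finrank ℝ Plane - 1 = 1 := by simp [Plane]
  have hy : ∀ y, y ^ (Module.finrank ℝ Plane - 1) • h y =
      (Ioi r).indicator (fun v => p * ((1 - interfererLaplace lam p α ε (σ / mu) v) * v)) y := by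
    intro y
    rw [hdim, pow_one, hdef, smul_eq_mul]
    by_cases hy : y ∈ Ioi r
    · rw [indicator_of_mem hy, indicator_of_mem hy]; ring
    · rw [indicator_of_notMem hy, indicator_of_notMem hy, mul_zero]
  have hsub : Ioi r ⊆ Ioi 0 := Ioi_subset_Ioi hr.le
  have hint : Integrable (fun z : Plane => h ‖z‖) := by
    rw [integrable_fun_norm_addHaar]
    simp_rw [hy]
    exact ((integrable_indicator_iff measurableSet_Ioi).2
      ((integrableOn_laplaceExponent hlam hp hα hβ hc hr).const_mul p)).integrableOn
  have hval : ∫ z : Plane, h ‖z‖ = 2 * Real.pi * p *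
      ∫ v in Ioi r, (1 - interfererLaplace lam p α ε (σ / mu) v) * v := by
    have hball : (volume : Measure Plane).real (Metric.ball 0 1) = Real.pi := by
      rw [Measure.real, EuclideanSpace.volume_ball_fin_two]
      simp [Real.pi_nonneg]
    have hdim2 : Module.finrank ℝ Plane = 2 := by simp [Plane]
    rw [integral_fun_norm_addHaar]
    simp_rw [hy]
    rw [setIntegral_indicator measurableSet_Ioi, inter_eq_self_of_subset_right hsub,
      integral_const_mul, hball, hdim2]
    simp only [nsmul_eq_mul, smul_eq_mul]
    push_cast
    ring
  rw [tailIntegral_eq_lintegral_indicator, lintegral_smul_measure, smul_eq_mul]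
  have hind : ∀ z : Plane, (Metric.closedBall 0 r)ᶜ.indicator (fun z => 1 -
      meanExpContribution α ε (UplinkModel.markLaw lam p mu) (ENNReal.ofReal σ) z) z =
      ENNReal.ofReal (h ‖z‖) := by
    intro z
    by_cases hz : r < ‖z‖
    · have hz' : z ∈ (Metric.closedBall (0 : Plane) r)ᶜ := by simpa using hz
      rw [indicator_of_mem hz', hdef, indicator_of_mem (mem_Ioi.2 hz),
        meanExpContribution_eq hlam hp hp1 hmu hσ]
    · have hz' : z ∉ (Metric.closedBall (0 : Plane) r)ᶜ := by simpa using hz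
      rw [indicator_of_notMem hz', hdef, indicator_of_notMem (notMem_Ioi.2 (not_lt.1 hz)), ENNReal.ofReal_zero]
  simp_rw [hind]
  rw [← ofReal_integral_eq_lintegral_ofReal hint (ae_of_all _ fun z => hh0 _),
    ← ENNReal.ofReal_mul hlam.le, hval, laplaceExponent]
  congr 1; ring

end interferer

/-! ### Conditional Laplace transform and coverage probability -/

lemma measurable_laplaceExponent (lam p α ε c : ℝ) :
    Measurable (laplaceExponent lam p α ε c) := by
  refine Measurable.const_mul ?_ _
  have h : (fun r => ∫ v in Ioi r, (1 - interfererLaplace lam p α ε c v) * v) = fun r =>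
      ∫ v, {x : ℝ × ℝ | x.1 < x.2}.indicator
        (fun x => (1 - interfererLaplace lam p α ε c x.2) * x.2) (r, v) := by
    ext r
    rw [← integral_indicator measurableSet_Ioi]
    rfl
  rw [h]
  refine (Measurable.stronglyMeasurable ?_).integral_prod_right.measurable
  refine Measurable.indicator ?_ (measurableSet_lt measurable_fst measurable_snd)
  exact (((measurable_interfererLaplace lam p α ε c).comp measurable_snd).const_sub 1).mul
    measurable_snd

lemma expMeasure_Ioi {r : ℝ} (hr : 0 < r) {x : ℝ} (hx : 0 ≤ x) :
    expMeasure r (Ioi x) = ENNReal.ofReal (Real.exp (-(r * x))) := by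
  have := isProbabilityMeasure_expMeasure hr
  have h := cdf_expMeasure_eq hr x
  rw [if_pos hx, cdf_eq_real] at h
  rw [← compl_Iic, prob_compl_eq_one_sub measurableSet_Iic, ← ofReal_measureReal, h,
    ← ENNReal.ofReal_one, ← ENNReal.ofReal_sub _ (by
      rw [sub_nonneg, Real.exp_le_one_iff]
      have := mul_nonneg hr.le hx
      linarith), sub_sub_cancel]

/-- A received power `G a` with exponential fading `G` exceeds `t` times the interference and noise
with probability exponentially small in the latter. -/
lemma expMeasure_lt_div {r t a : ℝ} (hr : 0 < r) (ht : 0 ≤ t) (ha : 0 < a) {D : ℝ≥0∞}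
    (hD : D ≠ ∞) :
    expMeasure r {g | ENNReal.ofReal t < ENNReal.ofReal (g * a) / D} =
      ENNReal.ofReal (Real.exp (-(r * (t * D.toReal / a)))) := by
  have h : {g | ENNReal.ofReal t < ENNReal.ofReal (g * a) / D} = Ioi (t * D.toReal / a) := by
    ext g
    have h1 : ENNReal.ofReal t * D = ENNReal.ofReal (t * D.toReal) := by
      rw [ENNReal.ofReal_mul ht, ENNReal.ofReal_toReal hD]
    change ENNReal.ofReal t < ENNReal.ofReal (g * a) / D ↔ t * D.toReal / a < g
    rw [ENNReal.lt_div_iff_mul_lt (Or.inr ENNReal.ofReal_ne_top) (Or.inl hD), h1,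
      ENNReal.ofReal_lt_ofReal_iff_of_nonneg (mul_nonneg ht ENNReal.toReal_nonneg),
      div_lt_iff₀ ha]
  rw [h, expMeasure_Ioi hr (by positivity)]

namespace UplinkModel

variable {Ω : Type*} [MeasurableSpace Ω] {P : Measure Ω} {lam p mu : ℝ}
  (M : UplinkModel P lam p mu)

/-- The pair of distances `(R_l, R_k)`. -/
noncomputable def distPair (l k : ℕ) (ω : Ω) : ℝ × ℝ := (M.dist l ω, M.dist k ω)

lemma measurable_distPair (l k : ℕ) : Measurable (M.distPair l k) :=
  (M.measurable_dist l).prodMk (M.measurable_dist k)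

/-- The SINR of the `l`-th user as a function of the locations, the fading of its transmission and
the marks. -/
noncomputable def seqSinr (α ε noise : ℝ) (l k : ℕ) (z : (ℕ → Plane) × ℝ × (ℕ → Mark)) : ℝ≥0∞ :=
  ENNReal.ofReal (z.2.1 * nthDist (seqUsers z.1) l ^ (α * (ε - 1))) /
    (seqInterference α ε (nthDist (seqUsers z.1) k) z.1 z.2.2 + ENNReal.ofReal noise)

lemma measurable_seqSinr (α ε noise : ℝ) (l k : ℕ) : Measurable (seqSinr α ε noise l k) := by
  have hI : Measurable fun z : (ℕ → Plane) × ℝ × (ℕ → Mark) =>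
      seqInterference α ε (nthDist (seqUsers z.1) k) z.1 z.2.2 := by
    have h : (fun z : (ℕ → Plane) × ℝ × (ℕ → Mark) =>
        seqInterference α ε (nthDist (seqUsers z.1) k) z.1 z.2.2) =
        (fun q : (ℕ → Plane) × (ℕ → Mark) =>
          seqInterference α ε (nthDist (seqUsers q.1) k) q.1 q.2) ∘ fun z => (z.1, z.2.2) :=
      funext fun _ => rfl
    rw [h]
    exact (measurable_seqInterference α ε k).comp
      (measurable_fst.prodMk (measurable_snd.comp measurable_snd))
  have hR : Measurable fun z : (ℕ → Plane) × ℝ × (ℕ → Mark) => nthDist (seqUsers z.1) l :=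
    (measurable_nthDist l).comp (measurable_seqUsers.comp measurable_fst)
  exact Measurable.div ((measurable_fst.comp measurable_snd).mul (hR.pow_const _)).ennreal_ofReal
    (hI.add_const _)

lemma seqSinr_points_marks (α ε noise : ℝ) (l k : ℕ) (ω : Ω) (g : ℝ) :
    seqSinr α ε noise l k (M.points ω, g, M.marks ω) =
      ENNReal.ofReal (g * M.dist l ω ^ (α * (ε - 1))) /
        (M.interference α ε k ω + ENNReal.ofReal noise) := by
  rw [M.interference_eq, M.dist_eq_nthDist, seqSinr]
  rfl

variable [IsProbabilityMeasure P]

lemma ae_dist_pos (hlam : 0 < lam) {j : ℕ} (hj : j ≠ 0) : ∀ᵐ ω ∂P, 0 < M.dist j ω :=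
  M.isPoissonPointProcess_users.ae_nthDist_pos hlam hj

lemma lintegral_mul_expNeg_interference_eq_laplaceExponent (hlam : 0 < lam) (hp : 0 < p)
    (hp1 : p ≤ 1) (hmu : 0 < mu) {α ε : ℝ} (hα : 2 < α) (hε : 0 ≤ ε) {l k : ℕ} (hl : 1 ≤ l)
    (hlk : l < k) {σ : ℝ} (hσ : 0 ≤ σ) {u : ℝ × ℝ → ℝ≥0∞} (hu : Measurable u) :
    ∫⁻ ω, u (M.distPair l k ω) * expNeg (ENNReal.ofReal σ * M.interference α ε k ω) ∂P =
      ∫⁻ ω, u (M.distPair l k ω) *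
        ENNReal.ofReal (Real.exp (-laplaceExponent lam p α ε (σ / mu) (M.dist k ω))) ∂P := by
  have h := M.lintegral_mul_expNeg_interference_eq hlam α ε hl hlk (ENNReal.ofReal σ) hu
  refine h.trans (lintegral_congr_ae ?_)
  have hk : k ≠ 0 := by omega
  filter_upwards [M.ae_dist_pos hlam hk] with ω hω
  have hβ : 0 ≤ α * ε / 2 := by positivity
  rw [tailIntegral_meanExpContribution hlam hp hp1 hmu hα hβ hσ hω,
    expNeg_ofReal (laplaceExponent_nonneg hlam hp (by positivity) hω)]
  rfl

/-- The interference is almost surely finite: as `s → 0`, `E[exp (-s I)]` tends to `P[I < ∞]` by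
dominated convergence, and to one by the explicit formula. -/
lemma ae_interference_lt_top (hlam : 0 < lam) (hp : 0 < p) (hp1 : p ≤ 1) (hmu : 0 < mu) {α ε : ℝ}
    (hα : 2 < α) (hε : 0 ≤ ε) {l k : ℕ} (hl : 1 ≤ l) (hlk : l < k) :
    ∀ᵐ ω ∂P, M.interference α ε k ω < ∞ := by
  have hI := M.measurable_interference α ε k
  have hk : k ≠ 0 := by omega
  have hβ : 0 ≤ α * ε / 2 := by positivity
  have hpos : ∀ n : ℕ, 0 ≤ 1 / ((n : ℝ) + 1) := fun n => by positivity
  have hlim : Tendsto (fun n : ℕ => 1 / ((n : ℝ) + 1)) atTop (𝓝 0) :=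
    tendsto_one_div_add_atTop_nhds_zero_nat
  have key : ∀ n : ℕ, ∫⁻ ω, expNeg (ENNReal.ofReal (1 / ((n : ℝ) + 1)) *
      M.interference α ε k ω) ∂P = ∫⁻ ω, ENNReal.ofReal (Real.exp
        (-laplaceExponent lam p α ε (1 / ((n : ℝ) + 1) / mu) (M.dist k ω))) ∂P := by
    intro n
    simpa using M.lintegral_mul_expNeg_interference_eq_laplaceExponent hlam hp hp1 hmu hα hε hl
      hlk (hpos n) (u := fun _ => 1) measurable_const
  have h1 : Tendsto (fun n : ℕ => ∫⁻ ω, ENNReal.ofReal (Real.exp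
      (-laplaceExponent lam p α ε (1 / ((n : ℝ) + 1) / mu) (M.dist k ω))) ∂P) atTop
      (𝓝 (∫⁻ _, 1 ∂P)) := by
    refine tendsto_lintegral_filter_of_dominated_convergence (fun _ => 1)
      (Eventually.of_forall fun n => ?_) (Eventually.of_forall fun n => ?_) (by simp) ?_
    · exact ((measurable_laplaceExponent lam p α ε _).comp
        (M.measurable_dist k)).neg.exp.ennreal_ofReal
    · filter_upwards [M.ae_dist_pos hlam hk] with ω hω
      rw [ENNReal.ofReal_le_one, Real.exp_le_one_iff, neg_nonpos]
      exact laplaceExponent_nonneg hlam hp (by positivity) hω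
    · filter_upwards [M.ae_dist_pos hlam hk] with ω hω
      have h2 : Tendsto (fun n : ℕ => 1 / ((n : ℝ) + 1) / mu) atTop (𝓝 0) := by
        simpa using hlim.div_const mu
      have h3 := tendsto_laplaceExponent hlam hp hα hβ (fun n => by positivity) h2 hω
      rw [laplaceExponent_zero hlam hp] at h3
      have h4 := ENNReal.tendsto_ofReal
        ((Real.continuous_exp.tendsto _).comp h3.neg)
      simpa using h4
  have h2 : Tendsto (fun n : ℕ => ∫⁻ ω, expNeg (ENNReal.ofReal (1 / ((n : ℝ) + 1)) *
      M.interference α ε k ω) ∂P) atTop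
      (𝓝 (∫⁻ ω, {ω | M.interference α ε k ω < ∞}.indicator (fun _ => 1) ω ∂P)) := by
    refine tendsto_lintegral_of_dominated_convergence (fun _ => 1)
      (fun n => measurable_expNeg.comp (hI.const_mul _))
      (fun n => ae_of_all _ fun ω => expNeg_le_one _) (by simp) (ae_of_all _ fun ω => ?_)
    by_cases hω : M.interference α ε k ω < ∞
    · rw [indicator_of_mem (by exact hω)]
      have h3 := ENNReal.Tendsto.mul_const (ENNReal.tendsto_ofReal hlim)
        (Or.inr hω.ne) (b := M.interference α ε k ω)
      have h4 := (continuous_expNeg.tendsto _).comp h3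
      simp only [ENNReal.ofReal_zero, zero_mul, expNeg_zero] at h4
      exact h4
    · rw [indicator_of_notMem (by exact hω)]
      have h3 : M.interference α ε k ω = ∞ := not_lt_top_iff.1 hω
      have h4 : ∀ n : ℕ, expNeg (ENNReal.ofReal (1 / ((n : ℝ) + 1)) *
          M.interference α ε k ω) = 0 := by
        intro n
        rw [h3, ENNReal.mul_top, expNeg_top]
        rw [Ne, ENNReal.ofReal_eq_zero, not_le]
        positivity
      simp_rw [h4]
      exact tendsto_const_nhds
  simp_rw [key] at h2
  have h3 := tendsto_nhds_unique h1 h2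
  have hm : MeasurableSet {ω | M.interference α ε k ω < ∞} := measurableSet_lt hI measurable_const
  rw [lintegral_indicator hm, setLIntegral_one, lintegral_one, measure_univ] at h3
  exact (prob_compl_eq_zero_iff hm).2 h3.symm

/-- The joint law of the distances and the interference, disintegrated over the distances. -/
lemma lintegral_distPair_interference (α ε : ℝ) (l k : ℕ) {f : (ℝ × ℝ) × ℝ≥0∞ → ℝ≥0∞}
    (hf : Measurable f) :
    ∫⁻ ω, f (M.distPair l k ω, M.interference α ε k ω) ∂P =
      ∫⁻ r, ∫⁻ i, f (r, i) ∂(condDistrib (M.interference α ε k) (M.distPair l k) P r)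
        ∂(P.map (M.distPair l k)) := by
  have hI := M.measurable_interference α ε k
  rw [← Measure.lintegral_compProd hf, compProd_map_condDistrib hI.aemeasurable,
    lintegral_map hf ((M.measurable_distPair l k).prodMk hI)]

lemma ae_condDistrib_ne_top (hlam : 0 < lam) (hp : 0 < p) (hp1 : p ≤ 1) (hmu : 0 < mu) {α ε : ℝ}
    (hα : 2 < α) (hε : 0 ≤ ε) {l k : ℕ} (hl : 1 ≤ l) (hlk : l < k) :
    ∀ᵐ r ∂(P.map (M.distPair l k)),
      ∀ᵐ i ∂(condDistrib (M.interference α ε k) (M.distPair l k) P r), i ≠ ∞ := by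
  have hI := M.measurable_interference α ε k
  refine Measure.ae_ae_of_ae_compProd (p := fun x => x.2 ≠ ∞) ?_
  rw [compProd_map_condDistrib hI.aemeasurable]
  refine (ae_map_iff ((M.measurable_distPair l k).prodMk hI).aemeasurable
    (measurable_snd (measurableSet_singleton ∞).compl)).2 ?_
  filter_upwards [M.ae_interference_lt_top hlam hp hp1 hmu hα hε hl hlk] with ω hω
  exact hω.ne

/-- The conditional Laplace transform, simultaneously at all nonnegative arguments: it suffices to
compare at countably many arguments, as both sides are continuous. -/
lemma ae_condLaplace_eq (hlam : 0 < lam) (hp : 0 < p) (hp1 : p ≤ 1) (hmu : 0 < mu) {α ε : ℝ}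
    (hα : 2 < α) (hε : 0 ≤ ε) {l k : ℕ} (hl : 1 ≤ l) (hlk : l < k) :
    ∀ᵐ r ∂(P.map (M.distPair l k)), 0 < r.1 ∧ ∀ σ, 0 ≤ σ → M.condLaplace α ε l k r.1 r.2 σ =
      Real.exp (-laplaceExponent lam p α ε (σ / mu) r.2) := by
  have hI := M.measurable_interference α ε k
  have hR := M.measurable_distPair l k
  have hβ : 0 ≤ α * ε / 2 := by positivity
  have hk0 : k ≠ 0 := by omega
  have hl0 : l ≠ 0 := by omega
  have : IsProbabilityMeasure (P.map (M.distPair l k)) :=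
    Measure.isProbabilityMeasure_map hR.aemeasurable
  have hpos : ∀ᵐ r ∂(P.map (M.distPair l k)), 0 < r.1 ∧ 0 < r.2 := by
    refine (ae_map_iff hR.aemeasurable ((measurableSet_lt measurable_const measurable_fst).inter
      (measurableSet_lt measurable_const measurable_snd))).2 ?_
    filter_upwards [M.ae_dist_pos hlam hl0, M.ae_dist_pos hlam hk0] with ω h1 h2
    exact ⟨h1, h2⟩
  have hfix : ∀ σ, 0 ≤ σ → ∀ᵐ r ∂(P.map (M.distPair l k)),
      ∫⁻ i, expNeg (ENNReal.ofReal σ * i)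
        ∂(condDistrib (M.interference α ε k) (M.distPair l k) P r) =
      ENNReal.ofReal (Real.exp (-laplaceExponent lam p α ε (σ / mu) r.2)) := by
    intro σ hσ
    have hfm : Measurable fun i : ℝ≥0∞ => expNeg (ENNReal.ofReal σ * i) := by fun_prop
    have hLm : Measurable fun r : ℝ × ℝ =>
        ENNReal.ofReal (Real.exp (-laplaceExponent lam p α ε (σ / mu) r.2)) :=
      ((measurable_laplaceExponent lam p α ε _).comp measurable_snd).neg.exp.ennreal_ofReal
    refine ae_eq_of_forall_setLIntegral_eq_of_sigmaFinite hfm.lintegral_kernel hLm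
      fun A hA _ => ?_
    have hone : Measurable (A.indicator fun _ => (1 : ℝ≥0∞)) := measurable_const.indicator hA
    have h1 := M.lintegral_distPair_interference α ε l k
      (f := fun x => A.indicator (fun _ => 1) x.1 * expNeg (ENNReal.ofReal σ * x.2))
      ((hone.comp measurable_fst).mul (hfm.comp measurable_snd))
    rw [M.lintegral_mul_expNeg_interference_eq_laplaceExponent hlam hp hp1 hmu hα hε hl hlk hσ
      hone] at h1
    have h2 : ∫⁻ ω, A.indicator (fun _ => 1) (M.distPair l k ω) *
        ENNReal.ofReal (Real.exp (-laplaceExponent lam p α ε (σ / mu) (M.dist k ω))) ∂P =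
        ∫⁻ r, A.indicator (fun _ => 1) r *
          ENNReal.ofReal (Real.exp (-laplaceExponent lam p α ε (σ / mu) r.2))
          ∂(P.map (M.distPair l k)) := by
      have hmul : Measurable fun r : ℝ × ℝ => A.indicator (fun _ => (1 : ℝ≥0∞)) r *
          ENNReal.ofReal (Real.exp (-laplaceExponent lam p α ε (σ / mu) r.2)) := hone.mul hLm
      rw [lintegral_map hmul hR]; rfl
    rw [h2] at h1
    simp only [lintegral_const_mul _ hfm] at h1
    have h3 : ∀ F : ℝ × ℝ → ℝ≥0∞, ∫⁻ r, A.indicator (fun _ => 1) r * F r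
        ∂(P.map (M.distPair l k)) = ∫⁻ r in A, F r ∂(P.map (M.distPair l k)) := by
      intro F
      rw [← lintegral_indicator hA]
      refine lintegral_congr fun r => ?_
      by_cases hr : r ∈ A <;> simp [hr]
    rw [h3, h3] at h1
    exact h1.symm
  -- the arguments are those of the form `gridCeil 0 n σ`
  have hcount : ∀ᵐ r ∂(P.map (M.distPair l k)), ∀ j n : ℕ,
      ∫⁻ i, expNeg (ENNReal.ofReal (0 + j / ((n : ℝ) + 1)) * i)
        ∂(condDistrib (M.interference α ε k) (M.distPair l k) P r) =
      ENNReal.ofReal (Real.exp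
        (-laplaceExponent lam p α ε ((0 + j / ((n : ℝ) + 1)) / mu) r.2)) :=
    ae_all_iff.2 fun j => ae_all_iff.2 fun n => hfix _ (by positivity)
  filter_upwards [hpos, hcount, M.ae_condDistrib_ne_top hlam hp hp1 hmu hα hε hl hlk]
    with r hr h1 h2
  refine ⟨hr.1, fun σ hσ => ?_⟩
  set κ := condDistrib (M.interference α ε k) (M.distPair l k) P r with hκ
  have hm : ∀ σ : ℝ, Measurable fun i : ℝ≥0∞ => Real.exp (-(σ * i.toReal)) := fun σ => by fun_prop
  have hint : ∀ σ, 0 ≤ σ → ∫ i, Real.exp (-(σ * i.toReal)) ∂κ =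
      (∫⁻ i, expNeg (ENNReal.ofReal σ * i) ∂κ).toReal := by
    intro σ hσ
    rw [integral_eq_lintegral_of_nonneg_ae (ae_of_all _ fun i => (Real.exp_pos _).le)
      (hm σ).aestronglyMeasurable]
    congr 1
    refine lintegral_congr_ae ?_
    filter_upwards [h2] with i hi
    rw [expNeg_eq_ofReal (ENNReal.mul_ne_top ENNReal.ofReal_ne_top hi), ENNReal.toReal_mul,
      ENNReal.toReal_ofReal hσ]
  have hg0 : ∀ n, 0 ≤ gridCeil 0 n σ := fun n => hσ.trans (le_gridCeil 0 n σ)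
  have hgl := tendsto_gridCeil hσ
  have t1 : Tendsto (fun n => ∫ i, Real.exp (-(gridCeil 0 n σ * i.toReal)) ∂κ) atTop
      (𝓝 (∫ i, Real.exp (-(σ * i.toReal)) ∂κ)) := by
    refine tendsto_integral_of_dominated_convergence (fun _ => 1)
      (fun n => (hm _).aestronglyMeasurable) (integrable_const 1)
      (fun n => ae_of_all _ fun i => ?_) (ae_of_all _ fun i => ?_)
    · rw [Real.norm_of_nonneg (Real.exp_pos _).le, Real.exp_le_one_iff, neg_nonpos]
      exact mul_nonneg (hg0 n) ENNReal.toReal_nonneg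
    · exact (Real.continuous_exp.tendsto _).comp (hgl.mul_const _).neg
  have t2 : Tendsto (fun n => Real.exp (-laplaceExponent lam p α ε (gridCeil 0 n σ / mu) r.2))
      atTop (𝓝 (Real.exp (-laplaceExponent lam p α ε (σ / mu) r.2))) :=
    (Real.continuous_exp.tendsto _).comp (tendsto_laplaceExponent hlam hp hα hβ
      (fun n => div_nonneg (hg0 n) hmu.le) (hgl.div_const mu) hr.2).neg
  refine tendsto_nhds_unique t1 (t2.congr fun n => ?_)
  rw [hint _ (hg0 n), gridCeil, h1, ENNReal.toReal_ofReal (Real.exp_pos _).le]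

/-- The fading of the target transmission may be integrated out first. -/
lemma lintegral_points_signalFading_marks (hmu : 0 < mu)
    {f : (ℕ → Plane) × ℝ × (ℕ → Mark) → ℝ≥0∞} (hf : Measurable f) :
    ∫⁻ ω, f (M.points ω, M.signalFading ω, M.marks ω) ∂P =
      ∫⁻ ω, ∫⁻ g, f (M.points ω, g, M.marks ω) ∂(expMeasure mu) ∂P := by
  have := isProbabilityMeasure_expMeasure hmu
  have hG := M.measurable_signalFading
  have hp := M.measurable_points
  have hm := M.measurable_marks
  have : IsProbabilityMeasure (P.map M.marks) := Measure.isProbabilityMeasure_map hm.aemeasurable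
  have e1 : P.map (fun ω => (M.signalFading ω, M.marks ω)) = (expMeasure mu).prod (P.map M.marks) := by
    rw [← M.signalFading_law]
    exact (indepFun_iff_map_prod_eq_prod_map_map hG.aemeasurable hm.aemeasurable).1
      M.signalFading_indep
  have e2 : P.map (fun ω => (M.points ω, M.signalFading ω, M.marks ω)) =
      (P.map M.points).prod ((expMeasure mu).prod (P.map M.marks)) := by
    rw [← e1]
    exact (indepFun_iff_map_prod_eq_prod_map_map hp.aemeasurable
      (hG.prodMk hm).aemeasurable).1 M.point_indep
  have e3 := (indepFun_iff_map_prod_eq_prod_map_map hp.aemeasurable hm.aemeasurable).1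
    M.indepFun_points_marks
  have hF : Measurable fun q : (ℕ → Plane) × (ℕ → Mark) =>
      ∫⁻ g, f (q.1, g, q.2) ∂(expMeasure mu) := by
    refine Measurable.lintegral_prod_right'
      (f := fun z : ((ℕ → Plane) × (ℕ → Mark)) × ℝ => f (z.1.1, z.2, z.1.2)) ?_
    fun_prop
  calc ∫⁻ ω, f (M.points ω, M.signalFading ω, M.marks ω) ∂P
      = ∫⁻ z, f z ∂(P.map fun ω => (M.points ω, M.signalFading ω, M.marks ω)) :=
        (lintegral_map hf (hp.prodMk (hG.prodMk hm))).symm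
    _ = ∫⁻ x, ∫⁻ m, ∫⁻ g, f (x, g, m) ∂(expMeasure mu) ∂(P.map M.marks) ∂(P.map M.points) := by
        rw [e2, lintegral_prod _ hf.aemeasurable]
        refine lintegral_congr fun x => ?_
        exact lintegral_prod_symm' (fun y => f (x, y)) (hf.comp (by fun_prop))
    _ = ∫⁻ q, ∫⁻ g, f (q.1, g, q.2) ∂(expMeasure mu) ∂((P.map M.points).prod (P.map M.marks)) :=
        (lintegral_prod _ hF.aemeasurable).symm
    _ = ∫⁻ ω, ∫⁻ g, f (M.points ω, g, M.marks ω) ∂(expMeasure mu) ∂P := by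
        rw [← e3, lintegral_map hF (hp.prodMk hm)]

/-- The coverage probability in terms of the distance to the target user and the interference: the
tail of its exponential fading. -/
lemma measure_lt_sinr (hlam : 0 < lam) (hp : 0 < p) (hp1 : p ≤ 1) (hmu : 0 < mu) {α ε : ℝ}
    (hα : 2 < α) (hε : 0 ≤ ε) {l k : ℕ} (hl : 1 ≤ l) (hlk : l < k) {noise t : ℝ}
    (hnoise : 0 ≤ noise) (ht : 0 ≤ t) :
    P {ω | ENNReal.ofReal t < M.sinr α ε noise l k ω} =
      ∫⁻ ω, ENNReal.ofReal (Real.exp (-(mu * t * noise * M.dist l ω ^ (α * (1 - ε)))) *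
        Real.exp (-(mu * t * M.dist l ω ^ (α * (1 - ε)) * (M.interference α ε k ω).toReal))) ∂P := by
  have hl0 : l ≠ 0 := by omega
  have hS := measurable_seqSinr α ε noise l k
  have hind : Measurable ((Ioi (ENNReal.ofReal t)).indicator fun _ => (1 : ℝ≥0∞)) :=
    measurable_const.indicator measurableSet_Ioi
  have hG := M.measurable_points.prodMk (M.measurable_signalFading.prodMk M.measurable_marks)
  have hsinr : M.sinr α ε noise l k =
      fun ω => seqSinr α ε noise l k (M.points ω, M.signalFading ω, M.marks ω) := by
    ext ω
    rw [M.seqSinr_points_marks, sinr]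
  have h1 : P {ω | ENNReal.ofReal t < M.sinr α ε noise l k ω} =
      ∫⁻ ω, (Ioi (ENNReal.ofReal t)).indicator (fun _ => 1)
        (seqSinr α ε noise l k (M.points ω, M.signalFading ω, M.marks ω)) ∂P := by
    have hm : MeasurableSet {ω | ENNReal.ofReal t < M.sinr α ε noise l k ω} := by
      rw [hsinr]
      exact measurableSet_lt measurable_const (hS.comp hG)
    rw [← setLIntegral_one, ← lintegral_indicator hm, hsinr]
    exact lintegral_congr fun ω => rfl
  rw [h1]
  refine (M.lintegral_points_signalFading_marks hmu (hind.comp hS)).trans ?_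
  refine lintegral_congr_ae ?_
  filter_upwards [M.ae_dist_pos hlam hl0, M.ae_interference_lt_top hlam hp hp1 hmu hα hε hl hlk]
    with ω hd hfin
  have h2 : ∫⁻ g, ((Ioi (ENNReal.ofReal t)).indicator (fun _ => (1 : ℝ≥0∞)) ∘
      seqSinr α ε noise l k) (M.points ω, g, M.marks ω) ∂(expMeasure mu) =
      expMeasure mu {g | ENNReal.ofReal t < ENNReal.ofReal (g * M.dist l ω ^ (α * (ε - 1))) /
        (M.interference α ε k ω + ENNReal.ofReal noise)} := by
    rw [← setLIntegral_one, ← lintegral_indicator]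
    · refine lintegral_congr fun g => ?_
      rw [Function.comp_apply, M.seqSinr_points_marks]
      rfl
    · refine measurableSet_lt measurable_const (Measurable.div ?_ measurable_const)
      fun_prop
  have hrpow : M.dist l ω ^ (α * (ε - 1)) = (M.dist l ω ^ (α * (1 - ε)))⁻¹ := by
    rw [← Real.rpow_neg hd.le]; congr 1; ring
  rw [h2, expMeasure_lt_div hmu ht (by positivity)
    (ENNReal.add_ne_top.2 ⟨hfin.ne, ENNReal.ofReal_ne_top⟩),
    ENNReal.toReal_add hfin.ne ENNReal.ofReal_ne_top, ENNReal.toReal_ofReal hnoise,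
    hrpow, div_inv_eq_mul, ← Real.exp_add]
  congr 2
  ring

lemma measurable_xi (α ε noise t : ℝ) (l k : ℕ) :
    Measurable fun r : ℝ × ℝ => M.xi α ε noise t l k r.1 r.2 := by
  refine Measurable.mul (by fun_prop) ?_
  have h : StronglyMeasurable fun x : (ℝ × ℝ) × ℝ≥0∞ =>
      Real.exp (-(mu * t * x.1.1 ^ (α * (1 - ε)) * x.2.toReal)) := by
    refine Measurable.stronglyMeasurable ?_
    fun_prop
  exact (h.integral_kernel_prod_right'
    (κ := condDistrib (M.interference α ε k) (M.distPair l k) P)).measurable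

lemma ofReal_xi {α ε noise t rl rk : ℝ} (hmu : 0 < mu) (ht : 0 ≤ t) (hrl : 0 < rl) (l k : ℕ) :
    ENNReal.ofReal (M.xi α ε noise t l k rl rk) =
      ∫⁻ i, ENNReal.ofReal (Real.exp (-(mu * t * noise * rl ^ (α * (1 - ε)))) *
        Real.exp (-(mu * t * rl ^ (α * (1 - ε)) * i.toReal)))
        ∂(condDistrib (M.interference α ε k) (M.distPair l k) P (rl, rk)) := by
  have hm : Measurable fun i : ℝ≥0∞ => Real.exp (-(mu * t * rl ^ (α * (1 - ε)) * i.toReal)) := by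
    fun_prop
  have hint : Integrable (fun i : ℝ≥0∞ => Real.exp (-(mu * t * rl ^ (α * (1 - ε)) * i.toReal)))
      (condDistrib (M.interference α ε k) (M.distPair l k) P (rl, rk)) := by
    refine Integrable.mono' (integrable_const 1) hm.aestronglyMeasurable (ae_of_all _ fun i => ?_)
    have h0 := ENNReal.toReal_nonneg (a := i)
    rw [Real.norm_of_nonneg (Real.exp_pos _).le, Real.exp_le_one_iff, neg_nonpos]
    positivity
  have hxi : M.xi α ε noise t l k rl rk =
      Real.exp (-(mu * t * noise * rl ^ (α * (1 - ε)))) *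
        ∫ i, Real.exp (-(mu * t * rl ^ (α * (1 - ε)) * i.toReal))
          ∂(condDistrib (M.interference α ε k) (M.distPair l k) P (rl, rk)) := rfl
  simp_rw [ENNReal.ofReal_mul (Real.exp_pos _).le]
  rw [lintegral_const_mul _ hm.ennreal_ofReal, hxi, ENNReal.ofReal_mul (Real.exp_pos _).le,
    ofReal_integral_eq_lintegral_ofReal hint (ae_of_all _ fun i => (Real.exp_pos _).le)]

lemma xi_nonneg (α ε noise t : ℝ) (l k : ℕ) (rl rk : ℝ) : 0 ≤ M.xi α ε noise t l k rl rk :=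
  mul_nonneg (Real.exp_pos _).le (integral_nonneg fun _ => (Real.exp_pos _).le)

/-- The coverage probability is the mean of the conditional one. -/
lemma measureReal_lt_sinr (hlam : 0 < lam) (hp : 0 < p) (hp1 : p ≤ 1) (hmu : 0 < mu) {α ε : ℝ}
    (hα : 2 < α) (hε : 0 ≤ ε) {l k : ℕ} (hl : 1 ≤ l) (hlk : l < k) {noise t : ℝ}
    (hnoise : 0 ≤ noise) (ht : 0 ≤ t) :
    P.real {ω | ENNReal.ofReal t < M.sinr α ε noise l k ω} =
      ∫ r, M.xi α ε noise t l k r.1 r.2 ∂(P.map (M.distPair l k)) := by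
  rw [integral_eq_lintegral_of_nonneg_ae (ae_of_all _ fun r => M.xi_nonneg _ _ _ _ _ _ _ _)
    (M.measurable_xi α ε noise t l k).aestronglyMeasurable, Measure.real,
    M.measure_lt_sinr hlam hp hp1 hmu hα hε hl hlk hnoise ht]
  congr 1
  have h := M.lintegral_distPair_interference α ε l k
    (f := fun x => ENNReal.ofReal (Real.exp (-(mu * t * noise * x.1.1 ^ (α * (1 - ε)))) *
      Real.exp (-(mu * t * x.1.1 ^ (α * (1 - ε)) * x.2.toReal)))) (by fun_prop)
  refine h.trans (lintegral_congr_ae ?_)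
  filter_upwards [M.ae_condLaplace_eq hlam hp hp1 hmu hα hε hl hlk] with r hr
  exact (M.ofReal_xi hmu ht hr.1 l k).symm

/-- Integration against the joint density of the two distances as an iterated integral. -/
lemma integral_distPair (hlam : 0 < lam) {l k : ℕ} (hl : 1 ≤ l) (hlk : l < k) {f : ℝ × ℝ → ℝ}
    (hf : Integrable f (P.map (M.distPair l k))) :
    ∫ r, f r ∂(P.map (M.distPair l k)) =
      ∫ rl in Ioi (0 : ℝ), ∫ rk in Ioi rl, f (rl, rk) * jointDistancePDF lam l k rl rk := by
  have hlaw : P.map (M.distPair l k) = (volume : Measure (ℝ × ℝ)).withDensity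
      (fun r => ENNReal.ofReal (jointDistancePDF lam l k r.1 r.2)) :=
    M.isPoissonPointProcess_users.map_nthDist_nthDist hlam hl hlk
  have hm := (measurable_jointDistancePDF lam l k).ennreal_ofReal
  have hnn : ∀ rl rk, 0 ≤ jointDistancePDF lam l k rl rk := by
    intro rl rk
    unfold jointDistancePDF
    split_ifs with h
    · have h1 : 0 ≤ rk := h.1.trans h.2
      have h2 : 0 ≤ rk ^ 2 - rl ^ 2 := by nlinarith [h.1, h.2]
      have h3 := h.1
      positivity
    · exact le_rfl
  rw [hlaw] at hf ⊢
  rw [integral_withDensity_eq_integral_toReal_smul hm (ae_of_all _ fun _ => ENNReal.ofReal_lt_top)]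
  rw [integrable_withDensity_iff_integrable_smul' hm (ae_of_all _ fun _ => ENNReal.ofReal_lt_top)]
    at hf
  simp_rw [ENNReal.toReal_ofReal (hnn _ _), smul_eq_mul, mul_comm _ (f _)] at hf ⊢
  rw [Measure.volume_eq_prod] at hf ⊢
  rw [integral_prod _ hf]
  have hinner : ∀ rl, ∫ rk, f (rl, rk) * jointDistancePDF lam l k rl rk =
      ∫ rk in Ioi rl, f (rl, rk) * jointDistancePDF lam l k rl rk := by
    intro rl
    rw [← integral_Ici_eq_integral_Ioi]
    refine (setIntegral_eq_integral_of_forall_compl_eq_zero fun rk hrk => ?_).symm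
    rw [jointDistancePDF, if_neg (fun h => hrk h.2), mul_zero]
  simp_rw [hinner]
  refine (setIntegral_eq_integral_of_forall_compl_eq_zero fun rl hrl => ?_).symm
  refine integral_eq_zero_of_ae (ae_of_all _ fun rk => ?_)
  have h0 : jointDistancePDF lam l k rl rk = 0 := by
    rw [jointDistancePDF]
    split_ifs with h
    · have : rl = 0 := le_antisymm (not_lt.1 hrl) h.1
      rw [this, zero_pow (by omega : 2 * l - 1 ≠ 0)]
      simp
    · rfl
  simp [h0]

end UplinkModel

theorem theorem1 {Ω : Type*} [MeasurableSpace Ω] (P : Measure Ω) [IsProbabilityMeasure P]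
    (lam p mu α ε noise t : ℝ) (l k : ℕ)
    (hlam : 0 < lam) (hp : 0 < p) (hp1 : p ≤ 1) (hmu : 0 < mu) (hα : 2 < α) (hε : 0 ≤ ε)
    (hnoise : 0 ≤ noise) (ht : 0 ≤ t) (hl : 1 ≤ l) (hlk : l < k)
    (M : UplinkModel P lam p mu) :
    -- the interference is almost surely finite
    (∀ᵐ ω ∂P, M.interference α ε k ω < ∞) ∧
    -- the joint law of the two distances
    P.map (fun ω => (M.dist l ω, M.dist k ω)) =
      (volume : Measure (ℝ × ℝ)).withDensity
        (fun r => ENNReal.ofReal (jointDistancePDF lam l k r.1 r.2)) ∧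
    -- the coverage probability is the mean of the conditional coverage probability
    P.real {ω | ENNReal.ofReal t < M.sinr α ε noise l k ω} =
      ∫ ω, M.xi α ε noise t l k (M.dist l ω) (M.dist k ω) ∂P ∧
    P.real {ω | ENNReal.ofReal t < M.sinr α ε noise l k ω} =
      ∫ rl in Ioi (0 : ℝ), ∫ rk in Ioi rl,
        M.xi α ε noise t l k rl rk * jointDistancePDF lam l k rl rk ∧
    -- the conditional Laplace transform of the interference
    (∀ᵐ r ∂(P.map (fun ω => (M.dist l ω, M.dist k ω))),
      M.condLaplace α ε l k r.1 r.2 (mu * t * r.1 ^ (α * (1 - ε))) =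
        Real.exp (-(2 * Real.pi * p * lam * ∫ v in Ioi r.2,
          (1 - ∫ q in Ioi (0 : ℝ), Real.pi * p * lam * Real.exp (-(p * lam * Real.pi * q)) /
            (1 + t * r.1 ^ (α * (1 - ε)) * q ^ (α * ε / 2) * v ^ (-α))) * v))) := by
  have hcov := M.measureReal_lt_sinr hlam hp hp1 hmu hα hε hl hlk hnoise ht
  have hxim := M.measurable_xi α ε noise t l k
  have hlap := M.ae_condLaplace_eq hlam hp hp1 hmu hα hε hl hlk
  have hR := M.measurable_distPair l k
  have hk0 : k ≠ 0 := by omega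
  have : IsProbabilityMeasure (P.map (M.distPair l k)) :=
    Measure.isProbabilityMeasure_map hR.aemeasurable
  refine ⟨M.ae_interference_lt_top hlam hp hp1 hmu hα hε hl hlk,
    M.isPoissonPointProcess_users.map_nthDist_nthDist hlam hl hlk, ?_, ?_, ?_⟩
  · rw [hcov, integral_map hR.aemeasurable hxim.aestronglyMeasurable]
    rfl
  · rw [hcov, M.integral_distPair hlam hl hlk]
    refine Integrable.mono' (integrable_const 1) hxim.aestronglyMeasurable ?_
    filter_upwards [hlap] with r hr
    have h1 := hr.1
    rw [Real.norm_of_nonneg (M.xi_nonneg _ _ _ _ _ _ _ _)]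
    refine mul_le_one₀ (Real.exp_le_one_iff.2 (neg_nonpos.2 (by positivity)))
      (integral_nonneg fun _ => (Real.exp_pos _).le) ?_
    refine (integral_mono_of_nonneg (g := fun _ => (1 : ℝ))
      (ae_of_all _ fun _ => (Real.exp_pos _).le) (integrable_const 1)
      (ae_of_all _ fun i => ?_)).trans (by simp)
    have h0 := ENNReal.toReal_nonneg (a := i)
    exact Real.exp_le_one_iff.2 (neg_nonpos.2 (by positivity))
  · filter_upwards [hlap] with r hr
    have h1 := hr.1
    rw [hr.2 _ (by positivity), show mu * t * r.1 ^ (α * (1 - ε)) / mu = t * r.1 ^ (α * (1 - ε)) by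
      field_simp]
    rfl
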